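/- Let $X$ be an arcwise-connected, second countable Hausdorff space with its Borel $\sigma$-algebra, and let $(\{Z(t)\}_{t\ge0},\{\mathbb P_x\}_{x\in X})$ be a (conservative) diffusion process on $X$: a measurable family of probability measures on the space $C([0,\infty),X)$ of continuous paths (with the $\sigma$-algebra generated by the coordinates, $(t,w)\mapsto w(t)$ being jointly measurable) with $\mathbb P_x[Z(0)=x]=1$, having the strong Markov property at all stopping times of the right-continuous natural filtration. Fix $x_1,x_2\in X$ and assume: (A1) there is a continuous map $R:X\to X$ with $R\circ R=\mathrm{id}$ and $\mathbb P_{x_1}\circ R^{-1}=\mathbb P_{x_2}$; (A2) with $H=\{x\in X: R(x)=x\}$, one has $X\setminus H=X_1\sqcup X_2$ with $X_1,X_2$ disjoint open sets and $R(X_1)=X_2$, labelled so that $x_1\notin X_2$. For a path $w$ let $\tau(w)=\inf\{t>0: w(t)\in H\}$, assumed to be a stopping time of the right-continuous natural filtration (this, like the joint measurability above, is automatic if $X$ is metrizable). The mirror coupling $\mathbb P_M$ is the law of $(Z_1,Z_2)$, where $Z_1$ has law $\mathbb P_{x_1}$, $Z_2(t)=RZ_1(t)$ for $t<\tau(Z_1)$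 and $Z_2(t)=Z_1(t)$ for $t\ge\tau(Z_1)$. Let $\mathscr C=\mathscr C(\mathbb P_{x_1},\mathbb P_{x_2})$ be the set of couplings of $\mathbb P_{x_1}$ and $\mathbb P_{x_2}$, i.e. of probability measures on pairs of paths $Z^*=(Z_1,Z_2)$ with marginals $\mathbb P_{x_1},\mathbb P_{x_2}$. Let $T=\inf\{t>0: Z_1(s)=Z_2(s)\ \forall s\ge t\}$. A coupling $\mathbb P$ is *maximal at* $t>0$ if $$\mathbb P[T>t]=\tfrac12\big\|\mathbb P_{x_1}\circ Z(t)^{-1}-\mathbb P_{x_2}\circ Z(t)^{-1}\big\|$$ (total variation norm), and *maximal* if this holds for all $t>0$. Let $\mathscr C_0\subset\mathscr C$ be the set of *Markovian* couplings: for every $s>0$, conditionally on $\sigma(Z^*(u):0\le u\le s)$, the shifted pair $(Z_1(s+\cdot),Z_2(s+\cdot))$ is a coupling of $\mathbb P_{Z_1(s)}$ and $\mathbb P_{Z_2(s)}$, that is, for $i=1,2$ the conditional law of $Z_i(s+\cdot)$ is $\mathbb P_{Z_i(s)}$. Let $\hat{\mathscr C}\subset\mathscr C$ be the set of couplings $\mathbb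 P$ such that for each $t>0$ there is a Borel set $\Xi^{(t)}\subset X_1\times X_2$ with $\mathbb P[Z^*(t)\in(X_1\times X_2)\setminus\Xi^{(t)}]=0$ such that every $(x,y)\in\Xi^{(t)}$ satisfies: if there is a decreasing sequence $s_n>0$ with $s_n\to0$ such that, for all $n$, $\mathbb P_x[Z(s_n)\in A]\ge\mathbb P_y[Z(s_n)\in A]$ for all Borel $A\subset X_1\cup H$ and $\mathbb P_x[Z(s_n)\in A']\le\mathbb P_y[Z(s_n)\in A']$ for all Borel $A'\subset X_2\cup H$, then $x=Ry$. **Theorem.** 1. Let $\mathbb P\in\hat{\mathscr C}\cap\mathscr C_0$. If there is $t_0>0$ such that $\mathbb P$ is maximal at every $t\in(0,t_0)$, then the law of the stopped process $Z^*(\cdot\wedge t_0)$ under $\mathbb P$ equals its law under $\mathbb P_M$. 2. In particular, if $\mathbb P\in\hat{\mathscr C}\cap\mathscr C_0$ is maximal, then $\mathbb P=\mathbb P_M$. 3. As a result, if $\hat{\mathscr C}\supset\mathscr C_0$, then $\mathbb P_M$ is the unique maximal coupling in $\mathscr C_0$ (it belongs to $\mathscr C_0$, is maximal, and is the only such coupling).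 -/

import Mathlib

open MeasureTheory ProbabilityTheory Filter Topology Set
open scoped NNReal ENNReal

/-! ### Path space -/

/-- The space of continuous paths `[0, ∞) → X`, with the σ-algebra generated by the
coordinate maps `w ↦ w t` (the instance inherited from the product `ℝ≥0 → X`). -/
abbrev PathSpace (X : Type*) [TopologicalSpace X] : Type _ :=
  {w : ℝ≥0 → X // Continuous w}

namespace PathSpace

variable {X : Type*} [TopologicalSpace X]

/-- The shift `(θ_s w)(t) = w (s + t)`. -/
def shift (s : ℝ≥0) (w : PathSpace X) : PathSpace X :=
  ⟨fun t => w.1 (s + t), w.2.comp (continuous_const.add continuous_id)⟩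

/-- The path stopped at time `t₀`, i.e. `t ↦ w (t ∧ t₀)`. -/
def stopAt (t₀ : ℝ≥0) (w : PathSpace X) : PathSpace X :=
  ⟨fun t => w.1 (min t t₀), w.2.comp (continuous_id.min continuous_const)⟩

/-- The image of a path under a continuous map of the state space. -/
def mapPath (R : C(X, X)) (w : PathSpace X) : PathSpace X :=
  ⟨fun t => R (w.1 t), R.continuous.comp w.2⟩

/-- The natural filtration `σ(w(u) ; 0 ≤ u ≤ s)` of the coordinate process. -/
def filtration (X : Type*) [TopologicalSpace X] [MeasurableSpace X] :
    Filtration ℝ≥0 (inferInstance : MeasurableSpace (PathSpace X)) where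
  seq s := ⨆ u ≤ s, MeasurableSpace.comap (fun w : PathSpace X => w.1 u) inferInstance
  mono' _ _ hij := biSup_mono fun _ h => h.trans hij
  le' s := by
    refine iSup₂_le fun u _ => Measurable.comap_le ?_
    exact (measurable_pi_apply u).comp measurable_subtype_coe

/-- The natural filtration `σ((w₁(u), w₂(u)) ; 0 ≤ u ≤ s)` of a pair of paths. -/
def pairFiltration (X : Type*) [TopologicalSpace X] [MeasurableSpace X] :
    Filtration ℝ≥0 (inferInstance : MeasurableSpace (PathSpace X × PathSpace X)) where
  seq s := ⨆ u ≤ s, MeasurableSpace.comap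
    (fun w : PathSpace X × PathSpace X => (w.1.1 u, w.2.1 u)) inferInstance
  mono' _ _ hij := biSup_mono fun _ h => h.trans hij
  le' s := by
    refine iSup₂_le fun u _ => Measurable.comap_le ?_
    have h : Measurable fun w : PathSpace X => w.1 u :=
      (measurable_pi_apply u).comp measurable_subtype_coe
    exact (h.comp measurable_fst).prodMk (h.comp measurable_snd)

/-- The hitting time `inf {t > 0 ; w(t) ∈ H}`, equal to `⊤` if there is no such `t`. -/
noncomputable def hittingTime (H : Set X) (w : PathSpace X) : WithTop ℝ≥0 :=
  sInf ((fun t : ℝ≥0 => (t : WithTop ℝ≥0)) '' {t | 0 < t ∧ w.1 t ∈ H})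

/-- The coupling time `inf {t > 0 ; w₁(s) = w₂(s) for all s ≥ t}`. -/
noncomputable def couplingTime (w : PathSpace X × PathSpace X) : WithTop ℝ≥0 :=
  sInf ((fun t : ℝ≥0 => (t : WithTop ℝ≥0)) ''
    {t | 0 < t ∧ ∀ s, t ≤ s → w.1.1 s = w.2.1 s})

/-- If the hitting time of a closed set is finite, it is attained. -/
theorem mem_of_hittingTime_eq {H : Set X} (hH : IsClosed H) {w : PathSpace X} {t : ℝ≥0}
    (h : hittingTime H w = t) : w.1 t ∈ H := by
  by_contra hn
  have hopen : IsOpen {s : ℝ≥0 | w.1 s ∉ H} := (hH.preimage w.2).isOpen_compl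
  obtain ⟨u, hu, hsub⟩ : ∃ u, t < u ∧ Ico t u ⊆ {s : ℝ≥0 | w.1 s ∉ H} :=
    exists_Ico_subset_of_mem_nhds (hopen.mem_nhds hn) ⟨t + 1, by simp⟩
  have hle : (u : WithTop ℝ≥0) ≤ hittingTime H w := by
    refine le_sInf ?_
    rintro _ ⟨s, ⟨hs0, hs⟩, rfl⟩
    have hts : (t : WithTop ℝ≥0) ≤ s := by
      rw [← h]
      exact sInf_le ⟨s, ⟨hs0, hs⟩, rfl⟩
    rw [WithTop.coe_le_coe] at hts ⊢
    by_contra hlt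
    exact hsub ⟨hts, not_le.1 hlt⟩ hs
  rw [h, WithTop.coe_le_coe] at hle
  exact absurd hu (not_lt.2 hle)

open Classical in
/-- The mirror image of a path: `R (w(t))` for `t < τ` and `w(t)` for `t ≥ τ`, where `τ` is the
hitting time of the set of fixed points of `R`. -/
noncomputable def mirror [T2Space X] (R : C(X, X)) (w : PathSpace X) : PathSpace X :=
  ⟨fun t => if (t : WithTop ℝ≥0) < hittingTime {x | R x = x} w then R (w.1 t) else w.1 t, by
    have hH : IsClosed {x | R x = x} := isClosed_eq R.continuous continuous_id
    generalize hτ : hittingTime {x | R x = x} w = τ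
    induction τ using WithTop.recTopCoe with
    | top =>
      simp only [WithTop.coe_lt_top, if_true]
      exact R.continuous.comp w.2
    | coe τ =>
      simp only [WithTop.coe_lt_coe]
      refine Continuous.if (fun a ha => ?_) (R.continuous.comp w.2) w.2
      have hle : {t : ℝ≥0 | t < τ} = Iio τ := rfl
      rcases eq_or_ne τ 0 with h0 | h0
      · subst h0
        simp at ha
      · have hne : (Iio τ).Nonempty := ⟨0, pos_iff_ne_zero.2 h0⟩
        rw [hle, frontier_Iio' hne] at ha
        rw [mem_singleton_iff] at ha
        subst ha
        exact mem_of_hittingTime_eq hH hτ⟩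

/-- On a metrizable space the map `(t, w) ↦ w(t)` is jointly measurable. -/
theorem measurable_eval_of_metrizable [TopologicalSpace.MetrizableSpace X] [MeasurableSpace X]
    [BorelSpace X] : Measurable fun p : ℝ≥0 × PathSpace X => p.2.1 p.1 := by
  have h := measurable_uncurry_of_continuous_of_measurable
    (u := fun (t : ℝ≥0) (w : PathSpace X) => w.1 t) (fun w => w.2)
    (fun t => (measurable_pi_apply t).comp measurable_subtype_coe)
  exact h

theorem measurable_eval_filtration [MeasurableSpace X] {u s : ℝ≥0} (h : u ≤ s) :
    @Measurable _ _ (filtration X s) _ fun w : PathSpace X => w.1 u :=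
  measurable_iff_comap_le.2
    (le_iSup₂_of_le (f := fun (u : ℝ≥0) (_ : u ≤ s) =>
      MeasurableSpace.comap (fun w : PathSpace X => w.1 u) inferInstance) u h le_rfl)

/-- On a metrizable space the hitting time of a closed set is a stopping time of the
right-continuous natural filtration. -/
theorem isStoppingTime_hittingTime_of_metrizable [TopologicalSpace.MetrizableSpace X]
    [MeasurableSpace X] [BorelSpace X] {H : Set X} (hH : IsClosed H) :
    IsStoppingTime (filtration X).rightCont (hittingTime H) := by
  let := TopologicalSpace.metrizableSpaceMetric X
  have hit : ∀ a b : ℝ≥0, a ≤ b →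
      MeasurableSet[filtration X b] {w : PathSpace X | ∃ s ∈ Icc a b, w.1 s ∈ H} := by
    intro a b hab
    rcases H.eq_empty_or_nonempty with rfl | hne
    · simp
    let c : ℝ≥0 → ℝ≥0 := fun u => max a (min u b)
    have hc : Continuous c := continuous_const.max (continuous_id.min continuous_const)
    have hcb : ∀ u, c u ≤ b := fun u => max_le hab (min_le_right _ _)
    have hca : ∀ u, a ≤ c u := fun u => le_max_left _ _
    have key : {w : PathSpace X | ∃ s ∈ Icc a b, w.1 s ∈ H} =
        ⋂ k : ℕ, ⋃ n : ℕ, {w : PathSpace X |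
          Metric.infDist (w.1 (c (TopologicalSpace.denseSeq ℝ≥0 n))) H < 1 / ((k : ℝ) + 1)} := by
      ext w
      have hcont : Continuous fun u => Metric.infDist (w.1 (c u)) H :=
        (Metric.continuous_infDist_pt H).comp (w.2.comp hc)
      simp only [mem_iInter, mem_iUnion, mem_ofPred_eq]
      constructor
      · rintro ⟨s, hs, hsH⟩ k
        have hcs : c s = s := by simp [c, hs.1, hs.2]
        have hpos : (0 : ℝ) < 1 / ((k : ℝ) + 1) := by positivity
        obtain ⟨n, hn⟩ := (TopologicalSpace.denseRange_denseSeq ℝ≥0).exists_mem_open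
          (isOpen_lt hcont (continuous_const (y := 1 / ((k : ℝ) + 1))))
          ⟨s, by simpa [hcs, Metric.infDist_zero_of_mem hsH] using hpos⟩
        exact ⟨n, hn⟩
      · intro h
        have hc2 : Continuous fun u => Metric.infDist (w.1 u) H :=
          (Metric.continuous_infDist_pt H).comp w.2
        obtain ⟨s, hs, hmin⟩ := (isCompact_Icc (a := a) (b := b)).exists_isMinOn
          ⟨a, le_rfl, hab⟩ hc2.continuousOn
        refine ⟨s, hs, ?_⟩
        rw [hH.mem_iff_infDist_zero hne]
        refine le_antisymm (le_of_forall_pos_lt_add fun ε hε => ?_) Metric.infDist_nonneg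
        obtain ⟨k, hk⟩ := exists_nat_one_div_lt hε
        obtain ⟨n, hn⟩ := h k
        have := hmin (show c (TopologicalSpace.denseSeq ℝ≥0 n) ∈ Icc a b from ⟨hca _, hcb _⟩)
        simp only [mem_ofPred_eq] at this
        linarith
    rw [key]
    refine MeasurableSet.iInter fun k => MeasurableSet.iUnion fun n => ?_
    have hm := (Metric.continuous_infDist_pt H).measurable.comp
      (measurable_eval_filtration (X := X) (hcb (TopologicalSpace.denseSeq ℝ≥0 n)))
    exact hm measurableSet_Iio
  intro i
  rw [Filtration.rightCont_eq]
  simp only [MeasurableSpace.measurableSet_iInf]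
  intro j hj
  obtain ⟨v, hv_anti, hv_gt, hv_lim⟩ := exists_seq_strictAnti_tendsto' hj
  have key : {w : PathSpace X | hittingTime H w ≤ (i : WithTop ℝ≥0)} =
      ⋂ n : ℕ, ⋃ m : ℕ, {w : PathSpace X | ∃ s ∈ Icc (min (1 / ((m : ℝ≥0) + 1)) (v n)) (v n),
        w.1 s ∈ H} := by
    ext w
    simp only [mem_iInter, mem_iUnion, mem_ofPred_eq]
    constructor
    · intro h n
      have hlt : hittingTime H w < (v n : WithTop ℝ≥0) :=
        h.trans_lt (WithTop.coe_lt_coe.2 (hv_gt n).1)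
      obtain ⟨_, ⟨s, ⟨hs0, hs⟩, rfl⟩, hsv⟩ := sInf_lt_iff.1 hlt
      obtain ⟨m, hm⟩ := exists_nat_one_div_lt hs0
      exact ⟨m, s, ⟨(min_le_left _ _).trans hm.le, (WithTop.coe_lt_coe.1 hsv).le⟩, hs⟩
    · intro h
      refine le_of_forall_gt_imp_ge_of_dense fun u hu => ?_
      induction u using WithTop.recTopCoe with
      | top => exact le_top
      | coe u =>
        rw [WithTop.coe_lt_coe] at hu
        obtain ⟨n, hn⟩ := (hv_lim.eventually (gt_mem_nhds hu)).exists
        obtain ⟨m, s, hs, hsH⟩ := h n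
        have hs0 : 0 < s := lt_of_lt_of_le
          (lt_min (by positivity) (lt_of_le_of_lt (zero_le) (hv_gt n).1)) hs.1
        have hle : hittingTime H w ≤ (s : WithTop ℝ≥0) := sInf_le ⟨s, ⟨hs0, hsH⟩, rfl⟩
        exact hle.trans (WithTop.coe_le_coe.2 (hs.2.trans hn.le))
  rw [key]
  refine MeasurableSet.iInter fun n => MeasurableSet.iUnion fun m => ?_
  exact (filtration X).mono (hv_gt n).2.le _ (hit _ _ (min_le_right _ _))

end PathSpace

open PathSpace

/-! ### Diffusion processes -/

/-- A (conservative) diffusion process on `X`: a measurable family `(P_x)` of probability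
measures on the space of continuous paths such that `P_x[w(0) = x] = 1` and the strong Markov
property holds: for every stopping time `σ` of the right-continuous natural filtration `(F_{t+})`,
conditionally on `F_{σ+}` and on `{σ < ∞}`, the path shifted by `σ` has law `P_{w(σ)}`.
The joint measurability of `(t, w) ↦ w(t)`, which makes `w(σ)` measurable, is automatic if `X`
is metrizable. -/
structure Diffusion (X : Type*) [TopologicalSpace X] [MeasurableSpace X] where
  law : Kernel X (PathSpace X)
  isMarkovKernel : IsMarkovKernel law
  law_start : ∀ x, ∀ᵐ w ∂(law x), w.1 0 = x
  measurable_eval : Measurable fun p : ℝ≥0 × PathSpace X => p.2.1 p.1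
  strong_markov : ∀ (σ : PathSpace X → WithTop ℝ≥0)
    (hσ : IsStoppingTime (filtration X).rightCont σ) (x : X)
    (B : Set (PathSpace X)), MeasurableSet[hσ.measurableSpace] B →
    ∀ A : Set (PathSpace X), MeasurableSet A →
      law x (B ∩ {w | σ w ≠ ⊤} ∩ {w | shift ((σ w).untopD 0) w ∈ A})
        = ∫⁻ w in B ∩ {w | σ w ≠ ⊤}, law (w.1 ((σ w).untopD 0)) A ∂(law x)

namespace Diffusion

variable {X : Type*} [TopologicalSpace X] [MeasurableSpace X]

instance (Z : Diffusion X) : IsMarkovKernel Z.law := Z.isMarkovKernel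

/-- The law of `Z(t)` under `P_x`. -/
noncomputable def lawAt (Z : Diffusion X) (t : ℝ≥0) (x : X) : Measure X :=
  (Z.law x).map fun w => w.1 t

instance (Z : Diffusion X) (t : ℝ≥0) (x : X) : IsFiniteMeasure (Z.lawAt t x) := by
  unfold lawAt; infer_instance

/-- `φ_t(x, y)`: half the total variation norm of `P_x ∘ Z(t)⁻¹ - P_y ∘ Z(t)⁻¹`. -/
noncomputable def phi (Z : Diffusion X) (t : ℝ≥0) (x y : X) : ℝ≥0∞ :=
  2⁻¹ * ((Z.lawAt t x).toSignedMeasure - (Z.lawAt t y).toSignedMeasure).totalVariation univ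

/-! ### Couplings -/

/-- The set of couplings of `P_x` and `P_y`. -/
def couplings (Z : Diffusion X) (x y : X) : Set (Measure (PathSpace X × PathSpace X)) :=
  {P | IsProbabilityMeasure P ∧ P.map Prod.fst = Z.law x ∧ P.map Prod.snd = Z.law y}

/-- `P` is maximal at time `t`: equality in the coupling inequality `P[T > t] ≥ φ_t(x, y)`. -/
def IsMaximalAt (Z : Diffusion X) (x y : X) (P : Measure (PathSpace X × PathSpace X))
    (t : ℝ≥0) : Prop :=
  P {w | (t : WithTop ℝ≥0) < couplingTime w} = Z.phi t x y

/-- `P` is maximal: it is maximal at every time `t > 0`. -/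
def IsMaximal (Z : Diffusion X) (x y : X) (P : Measure (PathSpace X × PathSpace X)) : Prop :=
  ∀ t : ℝ≥0, 0 < t → Z.IsMaximalAt x y P t

/-- The set of Markovian couplings: for each `s > 0`, conditionally on the joint past up to time
`s`, the shifted pair is a coupling of `P_{Z₁(s)}` and `P_{Z₂(s)}`, i.e. the conditional laws of
its two components are `P_{Z₁(s)}` and `P_{Z₂(s)}`. -/
def markovCouplings (Z : Diffusion X) (x y : X) : Set (Measure (PathSpace X × PathSpace X)) :=
  {P | P ∈ Z.couplings x y ∧ ∀ s : ℝ≥0, 0 < s → ∀ A : Set (PathSpace X), MeasurableSet A →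
    (P⟦{w | shift s w.1 ∈ A} | pairFiltration X s⟧ =ᵐ[P] fun w => (Z.law (w.1.1 s)).real A) ∧
    (P⟦{w | shift s w.2 ∈ A} | pairFiltration X s⟧ =ᵐ[P] fun w => (Z.law (w.2.1 s)).real A)}

/-! ### Reflection structure and mirror coupling -/

/-- The assumptions (A1) and (A2): `R` is a continuous involution of `X` which maps the law
`P_{x₁}` to `P_{x₂}`, and the complement of its set of fixed points is the disjoint union of the
open sets `X₁` and `X₂ = R(X₁)`. -/
structure ReflectionStructure (Z : Diffusion X) (x₁ x₂ : X) (R : C(X, X)) (X₁ X₂ : Set X) :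
    Prop where
  involutive : ∀ x, R (R x) = x
  map_law : (Z.law x₁).map (mapPath R) = Z.law x₂
  isOpen_left : IsOpen X₁
  isOpen_right : IsOpen X₂
  disjoint : Disjoint X₁ X₂
  union_eq : X₁ ∪ X₂ = {x | R x = x}ᶜ
  image_eq : R '' X₁ = X₂

/-- The mirror coupling: the law of `(Z₁, Z₂)` where `Z₁` has law `P_{x₁}` and `Z₂` is the mirror
image of `Z₁`. -/
noncomputable def mirrorCoupling [T2Space X] (Z : Diffusion X) (x₁ : X) (R : C(X, X)) :
    Measure (PathSpace X × PathSpace X) :=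
  (Z.law x₁).map fun w => (w, mirror R w)

/-- The class `Ĉ(P_{x₁}, P_{x₂})`. -/
def hatCouplings (Z : Diffusion X) (x₁ x₂ : X) (R : C(X, X)) (X₁ X₂ : Set X) :
    Set (Measure (PathSpace X × PathSpace X)) :=
  {P | P ∈ Z.couplings x₁ x₂ ∧ ∀ t : ℝ≥0, 0 < t → ∃ Ξ : Set (X × X), MeasurableSet Ξ ∧
    Ξ ⊆ X₁ ×ˢ X₂ ∧ P {w | (w.1.1 t, w.2.1 t) ∈ Ξᶜ ∩ X₁ ×ˢ X₂} = 0 ∧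
    ∀ x y : X, (x, y) ∈ Ξ →
      (∃ s : ℕ → ℝ≥0, Antitone s ∧ (∀ n, 0 < s n) ∧ Tendsto s atTop (𝓝 0) ∧
        ∀ n,
          (∀ A : Set X, MeasurableSet A → A ⊆ X₁ ∪ {z | R z = z} →
            Z.lawAt (s n) y A ≤ Z.lawAt (s n) x A) ∧
          (∀ A : Set X, MeasurableSet A → A ⊆ X₂ ∪ {z | R z = z} →
            Z.lawAt (s n) x A ≤ Z.lawAt (s n) y A)) →
      x = R y}

end Diffusion

/-! Write `τ` for the hitting time of the mirror `H`, `T` for the coupling time and `φ_t` for half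
the total variation distance at time `t`. The strong Markov property at `τ`, where the path sits on
a fixed point of `R`, shows that reflecting a path up to `τ` turns the law from `x₁` into the law
from `x₂` (`map_mirror`). The two laws at time `t` therefore differ only through the paths with `t <
τ`; these lie in `X₁`, their reflections in `X₂`, so the two contributions are mutually singular and
`φ_t = P_{x₁}[t < τ]` (`phi_eq`). Under the mirror coupling `T = τ` almost surely, which makes it
maximal; it is Markovian because reflection up to `τ` is adapted to the right-continuous filtration.

For uniqueness, equality in the coupling inequality at `t` forces `Z₁(t) ∈ X₁` and `Z₂(t) ∈ X₂` on
`{t < T}` (`ae_mem_and_mem_of_isMaximalAt`). So whenever `Z₂(s + r)` lies in `X₁ ∪ H`, the pair has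
already met. Conditioning a Markovian coupling on the past up to `s` turns this into a comparison of
the laws of `Z(r)` from `Z₁(s)` and from `Z₂(s)` on subsets of `X₁ ∪ H`, and symmetrically on
subsets of `X₂ ∪ H` (`ae_lawAt_le`). Letting `r` run through a sequence tending to `0` gives exactly
the hypothesis in the definition of `Ĉ`, whence `Z₁(s) = R Z₂(s)` on `{s < T}`
(`ae_eq_of_lt_couplingTime`).

Paths that mirror each other until they meet can only meet on `H`, so `t < τ` implies `t < T` for `t
< t₀`. Both events have probability `φ_t`, hence they agree almost surely, and `Z₂` is the mirror
image of `Z₁` up to `t₀` (`ae_stopAt_eq`). -/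

namespace PathSpace

variable {X : Type*} [TopologicalSpace X]

/-! ### Measurability of the operations on paths. -/

section Measurability

variable [MeasurableSpace X]

theorem measurable_coord (t : ℝ≥0) : Measurable fun w : PathSpace X => w.1 t :=
  (measurable_pi_apply t).comp measurable_subtype_coe

theorem measurable_of_coord {Ω : Type*} {m : MeasurableSpace Ω} {f : Ω → PathSpace X}
    (h : ∀ t, Measurable fun ω => (f ω).1 t) : Measurable f :=
  (measurable_pi_iff.2 h).subtype_mk

theorem measurable_shift (s : ℝ≥0) : Measurable (shift s : PathSpace X → PathSpace X) :=
  measurable_of_coord fun t => measurable_coord (s + t)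

theorem measurable_stopAt (s : ℝ≥0) : Measurable (stopAt s : PathSpace X → PathSpace X) :=
  measurable_of_coord fun t => measurable_coord (min t s)

theorem measurable_mapPath [BorelSpace X] (R : C(X, X)) :
    Measurable (mapPath R) :=
  measurable_of_coord fun t => R.continuous.measurable.comp (measurable_coord t)

theorem measurable_stopAt_filtration (s : ℝ≥0) :
    @Measurable _ _ (filtration X s) _ (stopAt s : PathSpace X → PathSpace X) :=
  measurable_of_coord fun t => measurable_eval_filtration (min_le_right t s)

theorem measurableSet_iSup_rightCont {A : Set (PathSpace X)} (hA : MeasurableSet A) :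
    MeasurableSet[⨆ t, (filtration X).rightCont t] A := by
  have h : @Measurable _ _ (⨆ t, (filtration X).rightCont t) _ (id : PathSpace X → PathSpace X) :=
    measurable_of_coord fun t => (measurable_eval_filtration (X := X) le_rfl).mono
      (((filtration X).le_rightCont t).trans (le_iSup (fun t => (filtration X).rightCont t) t))
      le_rfl
  exact h hA

end Measurability

/-! ### Hitting times, reflected paths and coupling times, path by path. -/

section HittingTime

variable {H : Set X} {w v : PathSpace X} {t : ℝ≥0}

theorem hittingTime_le (h0 : 0 < t) (h : w.1 t ∈ H) : hittingTime H w ≤ t :=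
  sInf_le ⟨t, ⟨h0, h⟩, rfl⟩

theorem notMem_of_lt_hittingTime (h0 : 0 < t) (h : (t : WithTop ℝ≥0) < hittingTime H w) :
    w.1 t ∉ H := fun hm => not_le.2 h (hittingTime_le h0 hm)

theorem le_hittingTime {a : WithTop ℝ≥0} (h : ∀ s : ℝ≥0, 0 < s → w.1 s ∈ H → a ≤ s) :
    a ≤ hittingTime H w := by
  refine le_sInf ?_
  rintro _ ⟨s, ⟨hs0, hs⟩, rfl⟩
  exact h s hs0 hs

theorem hittingTime_congr (h : ∀ t, w.1 t ∈ H ↔ v.1 t ∈ H) :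
    hittingTime H w = hittingTime H v := by
  simp only [hittingTime, h]

theorem le_coe_of_forall_lt {a : WithTop ℝ≥0} (h : ∀ s, t < s → a ≤ (s : WithTop ℝ≥0)) :
    a ≤ t := by
  refine le_of_forall_gt_imp_ge_of_dense fun u hu => ?_
  induction u using WithTop.recTopCoe with
  | top => exact le_top
  | coe u => exact h u (WithTop.coe_lt_coe.1 hu)

/-- The path stopped on hitting `H` still remembers when it was stopped; this lets `glue` recover
the hitting time from its first component alone. -/
theorem hittingTime_stopAt (hH : IsClosed H) (h : hittingTime H w = t) :
    hittingTime H (stopAt t w) = t := by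
  refine le_antisymm (le_coe_of_forall_lt fun s hs => ?_) (le_hittingTime fun s hs0 hs => ?_)
  · refine hittingTime_le (lt_of_le_of_lt zero_le hs) ?_
    simpa [stopAt, min_eq_right hs.le] using mem_of_hittingTime_eq hH h
  · rw [WithTop.coe_le_coe]
    by_contra! hlt
    have : w.1 s ∈ H := by simpa [stopAt, min_eq_left hlt.le] using hs
    have := hittingTime_le hs0 this
    rw [h, WithTop.coe_le_coe] at this
    exact not_lt.2 this hlt

theorem hittingTime_mapPath {R : C(X, X)} (hinv : ∀ x, R (R x) = x) (w : PathSpace X) :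
    hittingTime {x | R x = x} (mapPath R w) = hittingTime {x | R x = x} w :=
  hittingTime_congr fun t => by
    simp only [mapPath, mem_ofPred_eq, hinv]
    exact eq_comm

end HittingTime

section Mirror

variable [T2Space X] {R : C(X, X)} {w : PathSpace X} {t : ℝ≥0}

theorem isClosed_fixed (R : C(X, X)) : IsClosed {x | R x = x} :=
  isClosed_eq R.continuous continuous_id

theorem mirror_of_lt (h : (t : WithTop ℝ≥0) < hittingTime {x | R x = x} w) :
    (mirror R w).1 t = R (w.1 t) := if_pos h

theorem mirror_of_le (h : hittingTime {x | R x = x} w ≤ (t : WithTop ℝ≥0)) :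
    (mirror R w).1 t = w.1 t := if_neg (not_lt.2 h)

theorem hittingTime_mirror (hinv : ∀ x, R (R x) = x) (w : PathSpace X) :
    hittingTime {x | R x = x} (mirror R w) = hittingTime {x | R x = x} w :=
  hittingTime_congr fun t => by
    rcases lt_or_ge (t : WithTop ℝ≥0) (hittingTime {x | R x = x} w) with h | h
    · simp only [mirror_of_lt h, mem_ofPred_eq, hinv]
      exact eq_comm
    · rw [mirror_of_le h]

theorem mirror_mirror (hinv : ∀ x, R (R x) = x) (w : PathSpace X) :
    mirror R (mirror R w) = w := by
  refine Subtype.ext (funext fun t => ?_)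
  rcases lt_or_ge (t : WithTop ℝ≥0) (hittingTime {x | R x = x} w) with h | h
  · rw [mirror_of_lt (by rwa [hittingTime_mirror hinv]), mirror_of_lt h, hinv]
  · rw [mirror_of_le (by rwa [hittingTime_mirror hinv]), mirror_of_le h]

/-- The set of times at which two continuous paths in a Hausdorff space agree is closed, so the
infimum is attained. This includes the value `0`, although the definition only looks at positive
times. -/
theorem couplingTime_le_iff {p : PathSpace X × PathSpace X} :
    couplingTime p ≤ t ↔ ∀ s, t ≤ s → p.1.1 s = p.2.1 s := by
  constructor
  · intro h s hs
    have key : ∀ u, t < u → p.1.1 u = p.2.1 u := by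
      intro u hu
      obtain ⟨_, ⟨r, ⟨_, hr⟩, rfl⟩, hru⟩ :=
        sInf_lt_iff.1 (lt_of_le_of_lt h (WithTop.coe_lt_coe.2 hu))
      exact hr u (WithTop.coe_lt_coe.1 hru).le
    have hcl : IsClosed {u | p.1.1 u = p.2.1 u} := isClosed_eq p.1.2 p.2.2
    have : closure (Ioi t) ⊆ {u | p.1.1 u = p.2.1 u} := closure_minimal key hcl
    rw [closure_Ioi] at this
    exact this hs
  · intro h
    refine le_coe_of_forall_lt fun s hs => sInf_le ⟨s, ⟨lt_of_le_of_lt zero_le hs, ?_⟩, rfl⟩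
    exact fun u hu => h u (hs.le.trans hu)

theorem couplingTime_mirror_le (w : PathSpace X) :
    couplingTime (w, mirror R w) ≤ hittingTime {x | R x = x} w := by
  generalize hτ : hittingTime {x | R x = x} w = τ
  induction τ using WithTop.recTopCoe with
  | top => exact le_top
  | coe τ =>
    exact couplingTime_le_iff.2 fun s hs =>
      (mirror_of_le (by rw [hτ]; exact WithTop.coe_le_coe.2 hs)).symm

theorem measurableSet_lt_couplingTime [MeasurableSpace X] [MeasurableEq X] (t : ℝ≥0) :
    MeasurableSet {p : PathSpace X × PathSpace X | (t : WithTop ℝ≥0) < couplingTime p} := by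
  -- By continuity, agreement on `[t, ∞)` need only be tested at countably many times.
  have : {p : PathSpace X × PathSpace X | (t : WithTop ℝ≥0) < couplingTime p} =
      (⋂ n : ℕ, {p | p.1.1 (t + TopologicalSpace.denseSeq ℝ≥0 n) =
        p.2.1 (t + TopologicalSpace.denseSeq ℝ≥0 n)})ᶜ := by
    ext p
    rw [mem_ofPred_eq, ← not_le, couplingTime_le_iff, mem_compl_iff, not_iff_not]
    simp only [mem_iInter, mem_ofPred_eq]
    refine ⟨fun h n => h _ le_self_add, fun h s hs => ?_⟩
    have : (fun u => p.1.1 (t + u)) = fun u => p.2.1 (t + u) :=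
      Continuous.ext_on (TopologicalSpace.denseRange_denseSeq ℝ≥0)
        (p.1.2.comp (continuous_const.add continuous_id))
        (p.2.2.comp (continuous_const.add continuous_id)) (by rintro _ ⟨n, rfl⟩; exact h n)
    simpa [add_tsub_cancel_of_le hs] using congrFun this (s - t)
  rw [this]
  refine (MeasurableSet.iInter fun n => ?_).compl
  exact measurableSet_eq_fun ((measurable_coord _).comp measurable_fst)
    ((measurable_coord _).comp measurable_snd)

end Mirror

/-! ### Stopping times of the right-continuous filtration and the stopped path. -/

section StoppingTime

variable [MeasurableSpace X] {σ : PathSpace X → WithTop ℝ≥0}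

theorem measurable_untopD_min (hσ : IsStoppingTime (filtration X).rightCont σ) (i : ℝ≥0) :
    @Measurable _ _ ((filtration X).rightCont i) _
      fun w : PathSpace X => (min (σ w) (i : WithTop ℝ≥0)).untopD 0 := by
  refine measurable_of_Iic fun c => ?_
  have key : ∀ w, (min (σ w) (i : WithTop ℝ≥0)).untopD 0 ≤ c ↔ σ w ≤ c ∨ i ≤ c := by
    intro w
    induction σ w using WithTop.recTopCoe with
    | top =>
      rw [min_eq_right le_top, WithTop.untopD_coe]
      simp only [top_le_iff, WithTop.coe_ne_top, false_or]
    | coe a =>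
      rw [← WithTop.coe_min, WithTop.untopD_coe, WithTop.coe_le_coe]
      exact min_le_iff
  rcases le_or_gt i c with h | h
  · convert MeasurableSet.univ
    ext w
    exact iff_of_true ((key w).2 (Or.inr h)) trivial
  · have : (fun w : PathSpace X => (min (σ w) (i : WithTop ℝ≥0)).untopD 0) ⁻¹' Iic c =
        {w | σ w ≤ c} := by
      ext w
      exact (key w).trans (or_iff_left (not_le.2 h))
    rw [this]
    exact ((filtration X).rightCont.mono h.le) _ (hσ c)

theorem measurableSet_ne_top (hσ : IsStoppingTime (filtration X).rightCont σ) :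
    MeasurableSet {w | σ w ≠ ⊤} := by
  have : {w | σ w ≠ ⊤} = ⋃ n : ℕ, {w | σ w ≤ ((n : ℝ≥0) : WithTop ℝ≥0)} := by
    ext w
    simp only [mem_ofPred_eq, mem_iUnion]
    induction σ w using WithTop.recTopCoe with
    | top => simp
    | coe a =>
      obtain ⟨n, hn⟩ := exists_nat_ge a
      exact iff_of_true WithTop.coe_ne_top ⟨n, WithTop.coe_le_coe.2 hn⟩
  rw [this]
  exact MeasurableSet.iUnion fun n => (filtration X).rightCont.le _ _ (hσ n)

theorem measurable_untopD (hσ : IsStoppingTime (filtration X).rightCont σ) :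
    Measurable fun w : PathSpace X => (σ w).untopD 0 := by
  refine measurable_of_Iic fun c => ?_
  -- The default value `0` places all paths with `σ = ⊤` in this set.
  have : (fun w => (σ w).untopD 0) ⁻¹' Iic c = {w | σ w ≤ c} ∪ {w | σ w ≠ ⊤}ᶜ := by
    ext w
    simp only [mem_preimage, mem_Iic, mem_union, mem_ofPred_eq, mem_compl_iff, not_not]
    induction σ w using WithTop.recTopCoe with
    | top => simp
    | coe a => simp only [WithTop.untopD_coe, WithTop.coe_le_coe, WithTop.coe_ne_top, or_false]
  rw [this]
  exact ((filtration X).rightCont.le _ _ (hσ c)).union (measurableSet_ne_top hσ).compl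

theorem measurableSet_lt_of_isStoppingTime (hσ : IsStoppingTime (filtration X).rightCont σ)
    (t : ℝ≥0) : MeasurableSet[(filtration X).rightCont t] {w | (t : WithTop ℝ≥0) < σ w} := by
  have : {w | (t : WithTop ℝ≥0) < σ w} = {w | σ w ≤ t}ᶜ := by
    ext w
    exact (not_le (a := σ w) (b := (t : WithTop ℝ≥0))).symm
  rw [this]
  exact (hσ t).compl

theorem measurable_stopAt_time (heval : Measurable fun p : ℝ≥0 × PathSpace X => p.2.1 p.1)
    {Ω : Type*} {m : MeasurableSpace Ω} {ρ : Ω → ℝ≥0}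
    {f : Ω → PathSpace X} (hρ : Measurable ρ) (hf : Measurable f) :
    Measurable fun ω => stopAt (ρ ω) (f ω) :=
  measurable_of_coord fun _ => heval.comp ((measurable_const.min hρ).prodMk hf)

/-- The path up to `σ` belongs to the past of `σ`, so the strong Markov property applies to events
about it. On `{σ ≤ i}` the stopped path equals the path first stopped at `i`, then at `min σ i`, and
both operations only use the information available just after time `i`. -/
theorem measurableSet_stopAt_time (heval : Measurable fun p : ℝ≥0 × PathSpace X => p.2.1 p.1)
    (hσ : IsStoppingTime (filtration X).rightCont σ)
    {C : Set (PathSpace X)} (hC : MeasurableSet C) :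
    MeasurableSet[hσ.measurableSpace] ({w | stopAt ((σ w).untopD 0) w ∈ C} ∩ {w | σ w ≠ ⊤}) := by
  rw [hσ.measurableSet]
  refine ⟨measurableSet_iSup_rightCont (MeasurableSet.inter ?_ (measurableSet_ne_top hσ)),
    fun i => ?_⟩
  · exact measurable_stopAt_time heval (measurable_untopD hσ) measurable_id hC
  · have h := (measurable_stopAt_time heval (measurable_untopD_min hσ i)
      ((measurable_stopAt_filtration (X := X) i).mono ((filtration X).le_rightCont i) le_rfl)) hC
    convert h.inter (hσ i) using 1
    ext w
    simp only [mem_inter_iff, mem_ofPred_eq, mem_preimage]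
    generalize σ w = a
    induction a using WithTop.recTopCoe with
    | top => simp only [ne_eq, not_true_eq_false, and_false, top_le_iff,
        WithTop.coe_ne_top]
    | coe a =>
      simp only [ne_eq, WithTop.coe_ne_top, not_false_eq_true, and_true, WithTop.coe_le_coe,
        WithTop.untopD_coe]
      refine and_congr_left fun hle => ?_
      rw [min_eq_left (WithTop.coe_le_coe.2 hle), WithTop.untopD_coe]
      have : stopAt a (stopAt i w) = stopAt a w := by
        refine Subtype.ext (funext fun t => ?_)
        simp [stopAt, min_assoc, min_eq_left hle]
      rw [this]

end StoppingTime

/-! ### Cutting a path at the hitting time and gluing it back. -/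

section Glue

/-- The path stopped at the hitting time of `H`. -/
noncomputable def stopAtHit (H : Set X) (w : PathSpace X) : PathSpace X :=
  stopAt ((hittingTime H w).untopD 0) w

/-- The path shifted by the hitting time of `H`. -/
noncomputable def shiftAtHit (H : Set X) (w : PathSpace X) : PathSpace X :=
  shift ((hittingTime H w).untopD 0) w

open Classical in
/-- The trajectory which follows `p.1` until it hits `H` and then follows `p.2`. -/
noncomputable def glue (H : Set X) (p : PathSpace X × PathSpace X) (t : ℝ≥0) : X :=
  if (t : WithTop ℝ≥0) < hittingTime H p.1 then p.1.1 t
  else p.2.1 (t - (hittingTime H p.1).untopD 0)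

theorem glue_stopAtHit_shiftAtHit {H : Set X} (hH : IsClosed H) {w : PathSpace X}
    (hw : hittingTime H w ≠ ⊤) : glue H (stopAtHit H w, shiftAtHit H w) = w.1 := by
  obtain ⟨r, hr⟩ := WithTop.ne_top_iff_exists.1 hw
  funext t
  simp only [stopAtHit, shiftAtHit, glue, ← hr, WithTop.untopD_coe,
    hittingTime_stopAt hH hr.symm, WithTop.coe_lt_coe]
  split_ifs with h
  · simp [stopAt, min_eq_left h.le]
  · simp [shift, add_tsub_cancel_of_le (not_lt.1 h)]

theorem glue_mapPath_stopAtHit_shiftAtHit [T2Space X] {R : C(X, X)} (hinv : ∀ x, R (R x) = x)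
    {w : PathSpace X} (hw : hittingTime {x | R x = x} w ≠ ⊤) :
    glue {x | R x = x} (mapPath R (stopAtHit {x | R x = x} w), shiftAtHit {x | R x = x} w) =
      (mirror R w).1 := by
  obtain ⟨r, hr⟩ := WithTop.ne_top_iff_exists.1 hw
  funext t
  simp only [stopAtHit, shiftAtHit, glue, ← hr, WithTop.untopD_coe, hittingTime_mapPath hinv,
    hittingTime_stopAt (isClosed_fixed R) hr.symm, WithTop.coe_lt_coe]
  split_ifs with h
  · rw [mirror_of_lt (by rw [← hr]; exact WithTop.coe_lt_coe.2 h)]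
    simp [stopAt, mapPath, min_eq_left h.le]
  · rw [mirror_of_le (by rw [← hr]; exact WithTop.coe_le_coe.2 (not_lt.1 h))]
    simp [shift, add_tsub_cancel_of_le (not_lt.1 h)]

variable [MeasurableSpace X] {H : Set X}

theorem measurable_glue (heval : Measurable fun p : ℝ≥0 × PathSpace X => p.2.1 p.1)
    (hτ : IsStoppingTime (filtration X).rightCont (hittingTime H)) : Measurable (glue H) := by
  refine measurable_pi_iff.2 fun t => Measurable.ite ?_ ((measurable_coord t).comp measurable_fst) ?_
  · exact measurable_fst ((filtration X).rightCont.le _ _ (measurableSet_lt_of_isStoppingTime hτ t))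
  · exact heval.comp ((measurable_const.sub
      ((measurable_untopD hτ).comp measurable_fst)).prodMk measurable_snd)

theorem measurable_stopAtHit (heval : Measurable fun p : ℝ≥0 × PathSpace X => p.2.1 p.1)
    (hτ : IsStoppingTime (filtration X).rightCont (hittingTime H)) : Measurable (stopAtHit H) :=
  measurable_stopAt_time heval (measurable_untopD hτ) measurable_id

theorem measurable_shiftAtHit (heval : Measurable fun p : ℝ≥0 × PathSpace X => p.2.1 p.1)
    (hτ : IsStoppingTime (filtration X).rightCont (hittingTime H)) : Measurable (shiftAtHit H) :=
  measurable_of_coord fun _ =>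
    heval.comp (((measurable_untopD hτ).add measurable_const).prodMk measurable_id)

end Glue

end PathSpace

/-! ### Initial behaviour of paths and Blumenthal's zero-one law. -/

namespace PathSpace

variable {X : Type*} [TopologicalSpace X]

/-- The paths which stay in `U` at a dense set of times of some interval `(0, ε)`. -/
def initiallyIn (U : Set X) : Set (PathSpace X) :=
  {w | ∃ n : ℕ, ∀ k : ℕ, TopologicalSpace.denseSeq ℝ≥0 k ∈ Ioo 0 (1 / ((n : ℝ≥0) + 1)) →
    w.1 (TopologicalSpace.denseSeq ℝ≥0 k) ∈ U}

theorem disjoint_initiallyIn {U V : Set X} (h : Disjoint U V) :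
    Disjoint (initiallyIn U) (initiallyIn V) := by
  rw [Set.disjoint_left]
  rintro w ⟨n, hn⟩ ⟨m, hm⟩
  have hne : (Ioo (0 : ℝ≥0) (min (1 / ((n : ℝ≥0) + 1)) (1 / ((m : ℝ≥0) + 1)))).Nonempty :=
    nonempty_Ioo.2 (lt_min (by positivity) (by positivity))
  obtain ⟨k, hk⟩ := (TopologicalSpace.denseRange_denseSeq ℝ≥0).exists_mem_open isOpen_Ioo hne
  exact Set.disjoint_left.1 h (hn k ⟨hk.1, hk.2.trans_le (min_le_left _ _)⟩)
    (hm k ⟨hk.1, hk.2.trans_le (min_le_right _ _)⟩)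

theorem measurableSet_initiallyIn [MeasurableSpace X] {U : Set X} (hU : MeasurableSet U) :
    MeasurableSet[(filtration X).rightCont 0] (initiallyIn U) := by
  rw [Filtration.rightCont_eq]
  simp only [MeasurableSpace.measurableSet_iInf]
  intro j hj
  -- The event depends only on the germ of the path at `0`: the interval may be cut down to `(0, j)`
  -- for any `j > 0`, so the event is known by time `j`.
  have key : initiallyIn U = ⋃ n : ℕ, ⋂ k : ℕ, {w : PathSpace X |
      TopologicalSpace.denseSeq ℝ≥0 k ∈ Ioo 0 (min j (1 / ((n : ℝ≥0) + 1))) →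
        w.1 (TopologicalSpace.denseSeq ℝ≥0 k) ∈ U} := by
    ext w
    simp only [initiallyIn, mem_ofPred_eq, mem_iUnion, mem_iInter]
    constructor
    · rintro ⟨n, hn⟩
      exact ⟨n, fun k hk => hn k ⟨hk.1, hk.2.trans_le (min_le_right _ _)⟩⟩
    · rintro ⟨n, hn⟩
      obtain ⟨m, hm⟩ := exists_nat_one_div_lt (lt_min hj (by positivity : 0 < 1 / ((n : ℝ≥0) + 1)))
      exact ⟨m, fun k hk => hn k ⟨hk.1, hk.2.trans hm⟩⟩
  rw [key]
  refine MeasurableSet.iUnion fun n => MeasurableSet.iInter fun k => ?_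
  by_cases hk : TopologicalSpace.denseSeq ℝ≥0 k ∈ Ioo 0 (min j (1 / ((n : ℝ≥0) + 1)))
  · simp only [hk, true_imp_iff]
    exact measurable_eval_filtration (hk.2.le.trans (min_le_left _ _)) hU
  · simp only [hk, false_imp_iff]
    exact MeasurableSet.univ

end PathSpace

namespace Diffusion

variable {X : Type*} [TopologicalSpace X] [MeasurableSpace X]

theorem measurableSet_of_rightCont {A : Set (PathSpace X)} {t : ℝ≥0}
    (h : MeasurableSet[(filtration X).rightCont t] A) : MeasurableSet A :=
  (filtration X).rightCont.le t A h

theorem markov_rightCont (Z : Diffusion X) (x : X) (s : ℝ≥0) {B : Set (PathSpace X)}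
    (hB : MeasurableSet[(filtration X).rightCont s] B) {A : Set (PathSpace X)}
    (hA : MeasurableSet A) :
    Z.law x (B ∩ {w | shift s w ∈ A}) = ∫⁻ w in B, Z.law (w.1 s) A ∂(Z.law x) := by
  have h := Z.strong_markov (fun _ => (s : WithTop ℝ≥0)) (isStoppingTime_const _ s) x B
    (by rwa [IsStoppingTime.measurableSpace_const]) A hA
  have ht : {w : PathSpace X | (s : WithTop ℝ≥0) ≠ ⊤} = univ :=
    eq_univ_of_forall fun _ => WithTop.coe_ne_top
  simpa only [ht, inter_univ, WithTop.untopD_coe] using h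

/-- Blumenthal's zero-one law. -/
theorem zero_one (Z : Diffusion X) (x : X) {B : Set (PathSpace X)}
    (hB : MeasurableSet[(filtration X).rightCont 0] B) : Z.law x B = 0 ∨ Z.law x B = 1 := by
  have hB' := measurableSet_of_rightCont hB
  have h := Z.markov_rightCont x 0 hB hB'
  have hs : ∀ w : PathSpace X, shift 0 w = w := fun w =>
    Subtype.ext (funext fun t => by simp [shift])
  -- With the trivial shift by `0`, the Markov property reads `P(B) = P(B)²`.
  have hc : ∫⁻ w in B, Z.law (w.1 0) B ∂(Z.law x) = Z.law x B * Z.law x B := by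
    rw [← setLIntegral_const]
    refine lintegral_congr_ae (ae_restrict_of_ae ?_)
    filter_upwards [Z.law_start x] with w hw
    rw [hw]
  simp only [hs, ofPred_mem_eq, inter_self] at h
  rw [hc] at h
  rcases eq_or_ne (Z.law x B) 0 with h0 | h0
  · exact Or.inl h0
  · exact Or.inr ((ENNReal.eq_div_iff h0 (measure_ne_top _ _)).2 h.symm |>.trans
      (ENNReal.div_self h0 (measure_ne_top _ _)))

variable {Z : Diffusion X} {x₁ x₂ : X} {R : C(X, X)} {X₁ X₂ : Set X}

namespace ReflectionStructure

theorem mem_right_iff (hR : Z.ReflectionStructure x₁ x₂ R X₁ X₂) (x : X) : x ∈ X₂ ↔ R x ∈ X₁ := by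
  rw [← hR.image_eq]
  constructor
  · rintro ⟨y, hy, rfl⟩
    rwa [hR.involutive]
  · intro h
    exact ⟨R x, h, hR.involutive x⟩

theorem image_subset_or_subset (hR : Z.ReflectionStructure x₁ x₂ R X₁ X₂) {S : Set ℝ≥0}
    (hS : IsPreconnected S) {w : PathSpace X} (hw : ∀ t ∈ S, w.1 t ∉ {x | R x = x}) :
    w.1 '' S ⊆ X₁ ∨ w.1 '' S ⊆ X₂ := by
  refine (hS.image w.1 w.2.continuousOn).subset_or_subset hR.isOpen_left hR.isOpen_right
    hR.disjoint ?_
  rw [hR.union_eq]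
  rintro _ ⟨t, ht, rfl⟩
  exact hw t ht

theorem fixed_eq_compl (hR : Z.ReflectionStructure x₁ x₂ R X₁ X₂) :
    {x | R x = x} = (X₁ ∪ X₂)ᶜ := by rw [hR.union_eq, compl_compl]

theorem notMem_right (hR : Z.ReflectionStructure x₁ x₂ R X₁ X₂) {x : X}
    (h : x ∈ X₁ ∪ {x | R x = x}) : x ∉ X₂ := by
  intro h2
  rcases h with h | h
  · exact Set.disjoint_left.1 hR.disjoint h h2
  · rw [hR.fixed_eq_compl] at h
    exact h (Or.inr h2)

theorem notMem_left (hR : Z.ReflectionStructure x₁ x₂ R X₁ X₂) {x : X}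
    (h : x ∈ X₂ ∪ {x | R x = x}) : x ∉ X₁ := by
  intro h1
  rcases h with h | h
  · exact Set.disjoint_left.1 hR.disjoint h1 h
  · rw [hR.fixed_eq_compl] at h
    exact h (Or.inl h1)

variable [BorelSpace X]

theorem map_start (hR : Z.ReflectionStructure x₁ x₂ R X₁ X₂) : R x₁ = x₂ := by
  have h1 : ∀ᵐ w ∂(Z.law x₁), (mapPath R w).1 0 = x₂ := by
    have h := Z.law_start x₂
    rw [← hR.map_law] at h
    exact ae_of_ae_map (measurable_mapPath R).aemeasurable h
  obtain ⟨w, hw1, hw2⟩ := (h1.and (Z.law_start x₁)).exists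
  rw [← hw1, ← hw2]
  rfl

/-- A start on the mirror makes the law symmetric under `R`, so starting off inside `X₁` and inside
`X₂` are disjoint events of equal probability. By the zero-one law this probability is `0`. A path
with positive hitting time would, by connectedness, start off inside one of the two sides. -/
theorem ae_hittingTime_eq_zero (hR : Z.ReflectionStructure x₁ x₂ R X₁ X₂) (hx : R x₁ = x₁) :
    ∀ᵐ w ∂(Z.law x₁), hittingTime {x | R x = x} w = 0 := by
  have hm1 := measurableSet_initiallyIn hR.isOpen_left.measurableSet
  have hm2 := measurableSet_initiallyIn hR.isOpen_right.measurableSet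
  have heq : Z.law x₁ (initiallyIn X₂) = Z.law x₁ (initiallyIn X₁) := by
    have h := hR.map_law
    rw [← hR.map_start, hx] at h
    conv_rhs => rw [← h, Measure.map_apply (measurable_mapPath R) (measurableSet_of_rightCont hm1)]
    congr 1
    ext w
    simp only [initiallyIn, mem_ofPred_eq, mem_preimage, mapPath, hR.mem_right_iff]
  have h0 : Z.law x₁ (initiallyIn X₁) = 0 := by
    refine (Z.zero_one x₁ hm1).resolve_right fun h1 => ?_
    have h := measure_union (μ := Z.law x₁) (disjoint_initiallyIn hR.disjoint)
      (measurableSet_of_rightCont hm2)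
    rw [heq, h1] at h
    have h2 : Z.law x₁ (initiallyIn X₁ ∪ initiallyIn X₂) ≤ 1 := prob_le_one
    rw [h] at h2
    norm_num at h2
  filter_upwards [measure_eq_zero_iff_ae_notMem.1 h0,
    measure_eq_zero_iff_ae_notMem.1 (heq.trans h0)] with w hw1 hw2
  by_contra hne
  obtain ⟨n, hn⟩ : ∃ n : ℕ, ((1 / ((n : ℝ≥0) + 1) : ℝ≥0) : WithTop ℝ≥0) <
      hittingTime {x | R x = x} w := by
    generalize hittingTime {x | R x = x} w = a at hne
    induction a using WithTop.recTopCoe with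
    | top => exact ⟨0, WithTop.coe_lt_top _⟩
    | coe a =>
      have ha : a ≠ 0 := by
        rintro rfl
        exact hne rfl
      obtain ⟨n, hn⟩ := exists_nat_one_div_lt (pos_iff_ne_zero.2 ha)
      exact ⟨n, WithTop.coe_lt_coe.2 hn⟩
  -- The interval excludes `0`, where the path sits on the mirror itself.
  rcases hR.image_subset_or_subset (S := Ioo 0 (1 / ((n : ℝ≥0) + 1))) (w := w)
    isPreconnected_Ioo fun t ht =>
      notMem_of_lt_hittingTime ht.1 ((WithTop.coe_lt_coe.2 ht.2).trans hn) with h | h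
  · exact hw1 ⟨n, fun k hk => h (mem_image_of_mem _ hk)⟩
  · exact hw2 ⟨n, fun k hk => h (mem_image_of_mem _ hk)⟩

/-- A path cannot change sides without crossing `H`. If `x₁` lies on `H`, the hitting time vanishes
almost surely and there is nothing to check. -/
theorem ae_mem_left_of_lt_hittingTime (hR : Z.ReflectionStructure x₁ x₂ R X₁ X₂) (hx₁ : x₁ ∉ X₂) :
    ∀ᵐ w ∂(Z.law x₁), ∀ t : ℝ≥0, (t : WithTop ℝ≥0) < hittingTime {x | R x = x} w → w.1 t ∈ X₁ := by
  by_cases hx : R x₁ = x₁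
  · filter_upwards [hR.ae_hittingTime_eq_zero hx] with w hw t ht
    rw [hw] at ht
    exact absurd ht not_lt_zero
  · filter_upwards [Z.law_start x₁] with w hw t ht
    rcases hR.image_subset_or_subset (S := Iic t) (w := w) isPreconnected_Iic fun s hs => by
      rcases eq_or_ne s 0 with rfl | h0
      · rwa [hw]
      · exact notMem_of_lt_hittingTime (pos_iff_ne_zero.2 h0)
          ((WithTop.coe_le_coe.2 hs).trans_lt ht) with h | h
    · exact h (mem_image_of_mem _ self_mem_Iic)
    · exact absurd (hw ▸ h (mem_image_of_mem _ (mem_Iic.2 zero_le))) hx₁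

end ReflectionStructure

/-! ### Reflection up to the hitting time transports the law from `x₁` to the law from `x₂`. -/

variable [BorelSpace X] [T2Space X]

theorem measurable_mirror
    (hτ : IsStoppingTime (filtration X).rightCont (hittingTime {x | R x = x})) :
    Measurable (mirror R) :=
  measurable_of_coord fun t => Measurable.ite
    (measurableSet_of_rightCont (measurableSet_lt_of_isStoppingTime hτ t))
    (R.continuous.measurable.comp (measurable_coord t)) (measurable_coord t)

/-- The pair formed by the reflected path before `τ` and the path after `τ` has the same law under
`P_{x₁}` as the pair formed by the path before and after `τ` under `P_{x₂}`. -/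
theorem map_mapPath_stopAt_shift (hR : Z.ReflectionStructure x₁ x₂ R X₁ X₂)
    (hτ : IsStoppingTime (filtration X).rightCont (hittingTime {x | R x = x})) :
    ((Z.law x₁).restrict {w | hittingTime {x | R x = x} w ≠ ⊤}).map (fun w =>
      (mapPath R (stopAtHit {x | R x = x} w), shiftAtHit {x | R x = x} w)) =
    ((Z.law x₂).restrict {w | hittingTime {x | R x = x} w ≠ ⊤}).map (fun w =>
      (stopAtHit {x | R x = x} w,
        shiftAtHit {x | R x = x} w)) := by
  have hbefore := measurable_stopAtHit Z.measurable_eval hτ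
  have hshift := measurable_shiftAtHit Z.measurable_eval hτ
  have htop := measurableSet_ne_top hτ
  have hm1 : Measurable fun w : PathSpace X =>
      (mapPath R (stopAtHit {x | R x = x} w), shiftAtHit {x | R x = x} w) :=
    ((measurable_mapPath R).comp hbefore).prodMk hshift
  have hm2 : Measurable fun w : PathSpace X =>
      (stopAtHit {x | R x = x} w, shiftAtHit {x | R x = x} w) := hbefore.prodMk hshift
  refine Measure.ext_prod fun {C A} hC hA => ?_
  have hRC := measurable_mapPath R hC
  rw [Measure.map_apply hm1 (hC.prod hA),
    Measure.map_apply hm2 (hC.prod hA),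
    Measure.restrict_apply (hm1 (hC.prod hA)),
    Measure.restrict_apply (hm2 (hC.prod hA))]
  have key : ∀ (x : X) {D : Set (PathSpace X)}, MeasurableSet D →
      Z.law x ({w | stopAtHit {x | R x = x} w ∈ D} ∩ {w | hittingTime {x | R x = x} w ≠ ⊤} ∩
        {w | shiftAtHit {x | R x = x} w ∈ A}) =
      ∫⁻ w in {w | stopAtHit {x | R x = x} w ∈ D} ∩ {w | hittingTime {x | R x = x} w ≠ ⊤},
        Z.law (w.1 ((hittingTime {x | R x = x} w).untopD 0)) A ∂(Z.law x) := by
    intro x D hD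
    have h := Z.strong_markov _ hτ x _ (measurableSet_stopAt_time Z.measurable_eval hτ hD) A hA
    rwa [inter_assoc _ _ {w | hittingTime {x | R x = x} w ≠ ⊤}, inter_self] at h
  have e1 : (fun w => (mapPath R (stopAtHit {x | R x = x} w), shiftAtHit {x | R x = x} w)) ⁻¹' C ×ˢ A ∩
        {w | hittingTime {x | R x = x} w ≠ ⊤} =
      {w | stopAtHit {x | R x = x} w ∈ mapPath R ⁻¹' C} ∩
        {w | hittingTime {x | R x = x} w ≠ ⊤} ∩
        {w | shiftAtHit {x | R x = x} w ∈ A} := by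
    ext w
    simp only [mem_inter_iff, mem_preimage, mem_prod, mem_ofPred_eq]
    tauto
  have e2 : (fun w => (stopAtHit {x | R x = x} w,
        shiftAtHit {x | R x = x} w)) ⁻¹' C ×ˢ A ∩
        {w | hittingTime {x | R x = x} w ≠ ⊤} =
      {w | stopAtHit {x | R x = x} w ∈ C} ∩
        {w | hittingTime {x | R x = x} w ≠ ⊤} ∩
        {w | shiftAtHit {x | R x = x} w ∈ A} := by
    ext w
    simp only [mem_inter_iff, mem_preimage, mem_prod, mem_ofPred_eq]
    tauto
  rw [e1, e2, key x₁ hRC, key x₂ hC, ← hR.map_law]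
  have hmC : MeasurableSet ({w | stopAtHit {x | R x = x} w ∈ C} ∩
      {w | hittingTime {x | R x = x} w ≠ ⊤}) := (hbefore hC).inter htop
  have hmA : Measurable fun w : PathSpace X =>
      Z.law (w.1 ((hittingTime {x | R x = x} w).untopD 0)) A :=
    (Z.law.measurable_coe hA).comp
      (Z.measurable_eval.comp ((measurable_untopD hτ).prodMk measurable_id))
  rw [setLIntegral_map hmC hmA (measurable_mapPath R)]
  have hpre : mapPath R ⁻¹' ({w | stopAtHit {x | R x = x} w ∈ C} ∩
      {w | hittingTime {x | R x = x} w ≠ ⊤}) =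
      {w | stopAtHit {x | R x = x} w ∈ mapPath R ⁻¹' C} ∩
        {w | hittingTime {x | R x = x} w ≠ ⊤} := by
    ext w
    simp only [mem_preimage, mem_inter_iff, mem_ofPred_eq, stopAtHit,
      hittingTime_mapPath hR.involutive]
    rfl
  rw [hpre]
  refine setLIntegral_congr_fun (((hbefore hRC)).inter htop) fun w hw => ?_
  obtain ⟨r, hr⟩ := WithTop.ne_top_iff_exists.1 hw.2
  simp only [hittingTime_mapPath hR.involutive]
  rw [← hr, WithTop.untopD_coe]
  -- The restart point lies on the mirror, so reflecting the past leaves the law of the future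
  -- unchanged.
  have : R (w.1 r) = w.1 r := mem_of_hittingTime_eq (isClosed_fixed R) hr.symm
  simp [mapPath, this]

/-- The mirror image of the process started at `x₁` is the process started at `x₂`. -/
theorem map_mirror (hR : Z.ReflectionStructure x₁ x₂ R X₁ X₂)
    (hτ : IsStoppingTime (filtration X).rightCont (hittingTime {x | R x = x})) :
    (Z.law x₁).map (mirror R) = Z.law x₂ := by
  have hbefore := measurable_stopAtHit Z.measurable_eval hτ
  have hshift := measurable_shiftAtHit Z.measurable_eval hτ
  have htop := measurableSet_ne_top hτ
  have hm1 : Measurable fun w : PathSpace X =>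
      (mapPath R (stopAtHit {x | R x = x} w), shiftAtHit {x | R x = x} w) :=
    ((measurable_mapPath R).comp hbefore).prodMk hshift
  have hm2 : Measurable fun w : PathSpace X =>
      (stopAtHit {x | R x = x} w, shiftAtHit {x | R x = x} w) := hbefore.prodMk hshift
  ext A hA
  -- Gluing two unrelated paths may produce a discontinuous trajectory, so `glue` takes values in
  -- all functions and the event is taken as the trace of a product-measurable set `A'`.
  obtain ⟨A', hA', rfl⟩ := hA
  have hA : MeasurableSet (Subtype.val ⁻¹' A' : Set (PathSpace X)) := measurable_subtype_coe hA'
  rw [Measure.map_apply (measurable_mirror hτ) hA,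
    ← measure_inter_add_sdiff _ htop, ← measure_inter_add_sdiff (Subtype.val ⁻¹' A') htop]
  congr 1
  · have h := congrArg (fun μ => μ (glue {x | R x = x} ⁻¹' A')) (map_mapPath_stopAt_shift hR hτ)
    have hg := measurable_glue Z.measurable_eval hτ hA'
    rw [Measure.map_apply hm1 hg, Measure.map_apply hm2 hg, Measure.restrict_apply (hm1 hg),
      Measure.restrict_apply (hm2 hg)] at h
    convert h using 2
    · ext w
      simp only [mem_inter_iff, mem_preimage, mem_ofPred_eq]
      refine and_congr_left fun hw => ?_
      rw [← glue_mapPath_stopAtHit_shiftAtHit hR.involutive hw]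
    · ext w
      simp only [mem_inter_iff, mem_preimage, mem_ofPred_eq]
      refine and_congr_left fun hw => ?_
      rw [← glue_stopAtHit_shiftAtHit (isClosed_fixed R) hw]
  -- On paths that never hit the mirror, `mirror R` is plain reflection and (A1) suffices.
  · rw [← hR.map_law, Measure.map_apply (measurable_mapPath R) (hA.diff htop)]
    congr 1
    ext w
    simp only [Set.mem_sdiff, mem_preimage, mem_ofPred_eq, not_not, hittingTime_mapPath hR.involutive]
    refine and_congr_left fun hw => ?_
    have : mirror R w = mapPath R w :=
      Subtype.ext (funext fun t => mirror_of_lt (by rw [hw]; exact WithTop.coe_lt_top t))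
    rw [this]

end Diffusion

/-! ### The mirror coupling is a Markovian coupling. -/

namespace PathSpace

variable {X : Type*} [TopologicalSpace X] [MeasurableSpace X]

theorem measurable_coord_rightCont {u s : ℝ≥0} (hu : u ≤ s) :
    @Measurable _ _ ((filtration X).rightCont s) _ fun w : PathSpace X => w.1 u :=
  (measurable_eval_filtration hu).mono ((filtration X).le_rightCont s) le_rfl

theorem measurable_pairFiltration_iff {Ω : Type*} {m : MeasurableSpace Ω} {s : ℝ≥0}
    {g : Ω → PathSpace X × PathSpace X} :
    @Measurable _ _ m (pairFiltration X s) g ↔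
      ∀ u ≤ s, Measurable fun ω => ((g ω).1.1 u, (g ω).2.1 u) := by
  have h : (pairFiltration X s : MeasurableSpace (PathSpace X × PathSpace X)) =
    ⨆ u ≤ s, MeasurableSpace.comap
      (fun w : PathSpace X × PathSpace X => (w.1.1 u, w.2.1 u)) inferInstance := rfl
  rw [measurable_iff_comap_le, h]
  simp only [MeasurableSpace.comap_iSup, iSup_le_iff, MeasurableSpace.comap_comp,
    measurable_iff_comap_le]
  rfl

theorem measurable_fst_pairFiltration (s : ℝ≥0) :
    @Measurable _ _ (pairFiltration X s) _ fun w : PathSpace X × PathSpace X => w.1.1 s :=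
  measurable_fst.comp (measurable_pairFiltration_iff.1 measurable_id s le_rfl)

theorem measurable_snd_pairFiltration (s : ℝ≥0) :
    @Measurable _ _ (pairFiltration X s) _ fun w : PathSpace X × PathSpace X => w.2.1 s :=
  measurable_snd.comp (measurable_pairFiltration_iff.1 measurable_id s le_rfl)

end PathSpace

namespace Diffusion

variable {X : Type*} [TopologicalSpace X] [MeasurableSpace X]

theorem condExp_shift_of_forall_measure (Z : Diffusion X)
    {P : Measure (PathSpace X × PathSpace X)} [IsFiniteMeasure P]
    {π : PathSpace X × PathSpace X → PathSpace X} (hπm : Measurable π) {s : ℝ≥0}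
    (hπ : @Measurable _ _ (pairFiltration X s) _ fun w => (π w).1 s)
    {A : Set (PathSpace X)} (hA : MeasurableSet A)
    (h : ∀ B, MeasurableSet[pairFiltration X s] B →
      P (B ∩ {w | shift s (π w) ∈ A}) = ∫⁻ w in B, Z.law ((π w).1 s) A ∂P) :
    P⟦{w | shift s (π w) ∈ A} | pairFiltration X s⟧ =ᵐ[P] fun w => (Z.law ((π w).1 s)).real A := by
  have hle := (pairFiltration X).le s
  have hmA : MeasurableSet {w | shift s (π w) ∈ A} := (measurable_shift s).comp hπm hA
  have hg' : @Measurable _ _ (pairFiltration X s) _ fun w => Z.law ((π w).1 s) A :=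
    (Z.law.measurable_coe hA).comp hπ
  have hg : @Measurable _ _ (pairFiltration X s) _ fun w => (Z.law ((π w).1 s)).real A :=
    hg'.ennreal_toReal
  have hint : Integrable (fun w => (Z.law ((π w).1 s)).real A) P :=
    Integrable.of_bound (hg.mono hle le_rfl).aestronglyMeasurable 1
      (Eventually.of_forall fun w => by
        rw [Real.norm_of_nonneg measureReal_nonneg]; exact measureReal_le_one)
  refine (ae_eq_condExp_of_forall_setIntegral_eq hle ((integrable_const 1).indicator hmA)
    (fun B _ _ => hint.integrableOn) (fun B hB _ => ?_) hg.stronglyMeasurable.aestronglyMeasurable).symm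
  rw [setIntegral_indicator hmA, setIntegral_const, smul_eq_mul, mul_one, Measure.real, h B hB]
  refine integral_toReal (hg'.mono hle le_rfl).aemeasurable (Eventually.of_forall fun w => ?_)
  exact measure_lt_top _ _

/-- For a coupling driven by a single path, recovered by `π`, the joint past up to `s` is carried by
the path's own past just after `s`, so the Markov property of the diffusion passes to the component
`π`. -/
theorem condExp_shift_of_map (Z : Diffusion X) (x : X)
    {g : PathSpace X → PathSpace X × PathSpace X} (hgm : Measurable g)
    {π : PathSpace X × PathSpace X → PathSpace X} (hπm : Measurable π) (hπg : ∀ w, π (g w) = w)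
    {s : ℝ≥0} (hg : @Measurable _ _ ((filtration X).rightCont s) (pairFiltration X s) g)
    (hπ : @Measurable _ _ (pairFiltration X s) _ fun w => (π w).1 s)
    {A : Set (PathSpace X)} (hA : MeasurableSet A) :
    ((Z.law x).map g)⟦{w | shift s (π w) ∈ A} | pairFiltration X s⟧
      =ᵐ[(Z.law x).map g] fun w => (Z.law ((π w).1 s)).real A := by
  have hle := (pairFiltration X).le s
  refine Z.condExp_shift_of_forall_measure hπm hπ hA fun B hB => ?_
  have hmA : MeasurableSet {w | shift s (π w) ∈ A} := (measurable_shift s).comp hπm hA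
  have hmL : Measurable fun w => Z.law ((π w).1 s) A :=
    ((Z.law.measurable_coe hA).comp hπ).mono hle le_rfl
  rw [Measure.map_apply hgm ((hle _ hB).inter hmA), setLIntegral_map (hle _ hB) hmL hgm]
  have h := Z.markov_rightCont x s (hg hB) hA
  simp only [hπg]
  rw [← h]
  congr 1
  ext w
  simp [hπg]

variable [T2Space X] [BorelSpace X]
  {Z : Diffusion X} {x₁ x₂ : X} {R : C(X, X)} {X₁ X₂ : Set X}

/-- Whether `u < τ` is decided by the right-continuous filtration at time `u`; this is why the
Markov property is used relative to that filtration. -/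
theorem measurable_mirror_rightCont
    (hτ : IsStoppingTime (filtration X).rightCont (hittingTime {x | R x = x})) {u s : ℝ≥0}
    (hu : u ≤ s) :
    @Measurable _ _ ((filtration X).rightCont s) _ fun w : PathSpace X => (mirror R w).1 u := by
  have h : @Measurable _ _ ((filtration X).rightCont s) _ fun w : PathSpace X => w.1 u :=
    (measurable_eval_filtration hu).mono ((filtration X).le_rightCont s) le_rfl
  exact Measurable.ite ((filtration X).rightCont.mono hu _ (measurableSet_lt_of_isStoppingTime hτ u))
    (R.continuous.measurable.comp h) h

namespace ReflectionStructure

/-- Since `mirror R` is an involution, the coupling can also be driven by its second component, so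
both halves of the Markov property follow from the same lemma. -/
theorem mirrorCoupling_eq_map (hR : Z.ReflectionStructure x₁ x₂ R X₁ X₂)
    (hτ : IsStoppingTime (filtration X).rightCont (hittingTime {x | R x = x})) :
    Z.mirrorCoupling x₁ R = (Z.law x₂).map fun w => (mirror R w, w) := by
  have hm := measurable_mirror hτ
  have hm' : Measurable fun w : PathSpace X => (mirror R w, w) := hm.prodMk measurable_id
  rw [← map_mirror hR hτ, Measure.map_map hm' hm, mirrorCoupling]
  congr 1
  funext w
  simp [mirror_mirror hR.involutive]

theorem mirrorCoupling_mem_couplings (hR : Z.ReflectionStructure x₁ x₂ R X₁ X₂)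
    (hτ : IsStoppingTime (filtration X).rightCont (hittingTime {x | R x = x})) :
    Z.mirrorCoupling x₁ R ∈ Z.couplings x₁ x₂ := by
  have hm := measurable_id.prodMk (measurable_mirror hτ)
  refine ⟨Measure.isProbabilityMeasure_map hm.aemeasurable, ?_, ?_⟩
  · exact (Measure.map_map measurable_fst hm).trans Measure.map_id
  · exact (Measure.map_map measurable_snd hm).trans (map_mirror hR hτ)

theorem mirrorCoupling_mem_markovCouplings (hR : Z.ReflectionStructure x₁ x₂ R X₁ X₂)
    (hτ : IsStoppingTime (filtration X).rightCont (hittingTime {x | R x = x})) :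
    Z.mirrorCoupling x₁ R ∈ Z.markovCouplings x₁ x₂ := by
  refine ⟨hR.mirrorCoupling_mem_couplings hτ, fun s _ A hA => ⟨?_, ?_⟩⟩
  · exact Z.condExp_shift_of_map x₁ (measurable_id.prodMk (measurable_mirror hτ)) measurable_fst
      (fun _ => rfl) (measurable_pairFiltration_iff.2 fun u hu =>
        (measurable_coord_rightCont hu).prodMk (measurable_mirror_rightCont hτ hu))
      (measurable_fst_pairFiltration s) hA
  · rw [hR.mirrorCoupling_eq_map hτ]
    exact Z.condExp_shift_of_map x₂ ((measurable_mirror hτ).prodMk measurable_id) measurable_snd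
      (fun _ => rfl) (measurable_pairFiltration_iff.2 fun u hu =>
        (measurable_mirror_rightCont hτ hu).prodMk (measurable_coord_rightCont hu))
      (measurable_snd_pairFiltration s) hA

/-! ### Total variation distance and maximality. -/

theorem lawAt_right_apply (hR : Z.ReflectionStructure x₁ x₂ R X₁ X₂)
    (hτ : IsStoppingTime (filtration X).rightCont (hittingTime {x | R x = x})) (t : ℝ≥0)
    {A : Set X} (hA : MeasurableSet A) :
    Z.lawAt t x₂ A = Z.law x₁ {w | (mirror R w).1 t ∈ A} := by
  rw [lawAt, Measure.map_apply (measurable_coord t) hA, ← map_mirror hR hτ,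
    Measure.map_apply (measurable_mirror hτ) (measurable_coord t hA)]
  rfl

/-- From the hitting time on, a path and its mirror image coincide, so the two laws differ only
through paths with `t < τ`. The additive form avoids truncated subtraction. -/
theorem lawAt_eq_add (hR : Z.ReflectionStructure x₁ x₂ R X₁ X₂)
    (hτ : IsStoppingTime (filtration X).rightCont (hittingTime {x | R x = x})) (t : ℝ≥0)
    {A : Set X} (hA : MeasurableSet A) :
    Z.lawAt t x₁ A + Z.law x₁ ({w | (mirror R w).1 t ∈ A} ∩
        {w | (t : WithTop ℝ≥0) < hittingTime {x | R x = x} w}) =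
      Z.lawAt t x₂ A + Z.law x₁ ({w | w.1 t ∈ A} ∩
        {w | (t : WithTop ℝ≥0) < hittingTime {x | R x = x} w}) := by
  have hlt := measurableSet_of_rightCont (measurableSet_lt_of_isStoppingTime hτ t)
  rw [hR.lawAt_right_apply hτ t hA, lawAt, Measure.map_apply (measurable_coord t) hA,
    ← measure_inter_add_sdiff _ hlt, ← measure_inter_add_sdiff {w | (mirror R w).1 t ∈ A} hlt]
  have : (fun w : PathSpace X => w.1 t) ⁻¹' A \
      {w | (t : WithTop ℝ≥0) < hittingTime {x | R x = x} w} =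
      {w | (mirror R w).1 t ∈ A} \ {w | (t : WithTop ℝ≥0) < hittingTime {x | R x = x} w} := by
    ext w
    simp only [Set.mem_sdiff, mem_preimage, mem_ofPred_eq, not_lt]
    exact and_congr_left fun h => by rw [mirror_of_le h]
  rw [this, add_right_comm, add_comm]
  simp only [add_comm, add_left_comm]
  rfl

theorem ae_mirror_mem_right_of_lt_hittingTime
    (hR : Z.ReflectionStructure x₁ x₂ R X₁ X₂) (hx₁ : x₁ ∉ X₂) :
    ∀ᵐ w ∂(Z.law x₁), ∀ t : ℝ≥0, (t : WithTop ℝ≥0) < hittingTime {x | R x = x} w →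
      (mirror R w).1 t ∈ X₂ := by
  filter_upwards [hR.ae_mem_left_of_lt_hittingTime hx₁] with w hw t ht
  rw [mirror_of_lt ht, hR.mem_right_iff, hR.involutive]
  exact hw t ht

/-- Half the total variation distance of the laws at time `t` is the probability not to have hit
the mirror before `t`. -/
theorem phi_eq (hR : Z.ReflectionStructure x₁ x₂ R X₁ X₂)
    (hx₁ : x₁ ∉ X₂) (hτ : IsStoppingTime (filtration X).rightCont (hittingTime {x | R x = x}))
    (t : ℝ≥0) :
    Z.phi t x₁ x₂ = Z.law x₁ {w | (t : WithTop ℝ≥0) < hittingTime {x | R x = x} w} := by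
  set E := {w : PathSpace X | (t : WithTop ℝ≥0) < hittingTime {x | R x = x} w}
  have hE : MeasurableSet E := measurableSet_of_rightCont (measurableSet_lt_of_isStoppingTime hτ t)
  have hm1 := measurable_coord (X := X) t
  have hm2 : Measurable fun w : PathSpace X => (mirror R w).1 t :=
    (measurable_coord t).comp (measurable_mirror hτ)
  let ν₁ : Measure X := ((Z.law x₁).restrict E).map fun w => w.1 t
  let ν₂ : Measure X := ((Z.law x₁).restrict E).map fun w => (mirror R w).1 t
  have hs : ν₁ ⟂ₘ ν₂ := by
    refine ⟨X₁ᶜ, hR.isOpen_left.measurableSet.compl, ?_, ?_⟩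
    · rw [Measure.map_apply hm1 hR.isOpen_left.measurableSet.compl, measure_eq_zero_iff_ae_notMem,
        ae_restrict_iff' hE]
      filter_upwards [hR.ae_mem_left_of_lt_hittingTime hx₁] with w hw hwE
      simpa using hw t hwE
    · rw [compl_compl, Measure.map_apply hm2 hR.isOpen_left.measurableSet,
        measure_eq_zero_iff_ae_notMem, ae_restrict_iff' hE]
      filter_upwards [hR.ae_mirror_mem_right_of_lt_hittingTime hx₁] with w hw hwE
      exact fun h => Set.disjoint_left.1 hR.disjoint h (hw t hwE)
  -- By uniqueness of the Jordan decomposition, a mutually singular pair with the right difference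
  -- gives the total variation.
  let j : JordanDecomposition X := ⟨ν₁, ν₂, hs⟩
  have hj : (Z.lawAt t x₁).toSignedMeasure - (Z.lawAt t x₂).toSignedMeasure = j.toSignedMeasure := by
    ext A hA
    have h := hR.lawAt_eq_add hτ t hA
    have h' := congrArg ENNReal.toReal h
    rw [ENNReal.toReal_add (measure_ne_top _ _) (measure_ne_top _ _),
      ENNReal.toReal_add (measure_ne_top _ _) (measure_ne_top _ _)] at h'
    have e1 : ν₁ A = Z.law x₁ ({w | w.1 t ∈ A} ∩ E) := by
      rw [Measure.map_apply hm1 hA, Measure.restrict_apply (hm1 hA)]; rfl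
    have e2 : ν₂ A = Z.law x₁ ({w | (mirror R w).1 t ∈ A} ∩ E) := by
      rw [Measure.map_apply hm2 hA, Measure.restrict_apply (hm2 hA)]; rfl
    rw [JordanDecomposition.toSignedMeasure, Measure.toSignedMeasure_sub_apply hA,
      Measure.toSignedMeasure_sub_apply hA]
    simp only [Measure.real, j, e1, e2]
    linarith
  rw [phi, SignedMeasure.totalVariation, SignedMeasure.toJordanDecomposition_eq hj,
    Measure.add_apply]
  have e1 : j.posPart univ = Z.law x₁ E := by
    change ν₁ univ = _
    simp [ν₁, Measure.map_apply hm1 MeasurableSet.univ]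
  have e2 : j.negPart univ = Z.law x₁ E := by
    change ν₂ univ = _
    simp [ν₂, Measure.map_apply hm2 MeasurableSet.univ]
  rw [e1, e2, ← two_mul, ← mul_assoc, ENNReal.inv_mul_cancel two_ne_zero ENNReal.ofNat_ne_top,
    one_mul]

/-- If `A` contains `X₁` and is disjoint from `X₂`, the masses of `A` under the laws at time `t`
differ by the probability not to have hit the mirror before `t`. -/
theorem lawAt_eq_add_of_subset (hR : Z.ReflectionStructure x₁ x₂ R X₁ X₂)
    (hx₁ : x₁ ∉ X₂) (hτ : IsStoppingTime (filtration X).rightCont (hittingTime {x | R x = x}))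
    (t : ℝ≥0) {A : Set X} (hA : MeasurableSet A) (h1 : X₁ ⊆ A) (h2 : Disjoint A X₂) :
    Z.lawAt t x₁ A = Z.lawAt t x₂ A +
      Z.law x₁ {w | (t : WithTop ℝ≥0) < hittingTime {x | R x = x} w} := by
  have h := hR.lawAt_eq_add hτ t hA
  have e1 : Z.law x₁ ({w | (mirror R w).1 t ∈ A} ∩
      {w | (t : WithTop ℝ≥0) < hittingTime {x | R x = x} w}) = 0 := by
    rw [measure_eq_zero_iff_ae_notMem]
    filter_upwards [hR.ae_mirror_mem_right_of_lt_hittingTime hx₁] with w hw hwE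
    exact Set.disjoint_left.1 h2 hwE.1 (hw t hwE.2)
  have e2 : Z.law x₁ ({w | w.1 t ∈ A} ∩ {w | (t : WithTop ℝ≥0) < hittingTime {x | R x = x} w}) =
      Z.law x₁ {w | (t : WithTop ℝ≥0) < hittingTime {x | R x = x} w} := by
    refine measure_congr ?_
    filter_upwards [hR.ae_mem_left_of_lt_hittingTime hx₁] with w hw
    exact propext ⟨fun h => h.2, fun h => ⟨h1 (hw t h), h⟩⟩
  rwa [e1, e2, add_zero] at h

/-- If the pair has not met at time `t`, a coupling which is maximal at `t` has its components on
different sides of the mirror. -/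
theorem ae_mem_and_mem_of_isMaximalAt (hR : Z.ReflectionStructure x₁ x₂ R X₁ X₂)
    (hx₁ : x₁ ∉ X₂) (hτ : IsStoppingTime (filtration X).rightCont (hittingTime {x | R x = x}))
    {P : Measure (PathSpace X × PathSpace X)} (hP : P ∈ Z.couplings x₁ x₂) {t : ℝ≥0}
    (hmax : Z.IsMaximalAt x₁ x₂ P t) :
    ∀ᵐ w ∂P, (t : WithTop ℝ≥0) < couplingTime w → w.1.1 t ∈ X₁ ∧ w.2.1 t ∈ X₂ := by
  obtain ⟨hprob, hfst, hsnd⟩ := hP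
  have hm1 : Measurable fun w : PathSpace X × PathSpace X => w.1.1 t :=
    (measurable_coord t).comp measurable_fst
  have hm2 : Measurable fun w : PathSpace X × PathSpace X => w.2.1 t :=
    (measurable_coord t).comp measurable_snd
  -- Having `Z₁(t) ∈ A` and `Z₂(t) ∉ A` forces `t < T`, and by maximality this event is at least as
  -- probable as `{t < T}`, so the two agree almost surely. The choice `A = X₁` locates `Z₁(t)`, and
  -- `A = X₂ᶜ` locates `Z₂(t)`.
  have key : ∀ A : Set X, MeasurableSet A → X₁ ⊆ A → Disjoint A X₂ →
      ∀ᵐ w ∂P, (t : WithTop ℝ≥0) < couplingTime w → w.1.1 t ∈ A ∧ w.2.1 t ∉ A := by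
    intro A hA h1 h2
    have h := hR.lawAt_eq_add_of_subset hx₁ hτ t hA h1 h2
    rw [← hR.phi_eq hx₁ hτ, ← hmax, lawAt, lawAt, ← hfst, ← hsnd,
      Measure.map_map (measurable_coord t) measurable_fst,
      Measure.map_map (measurable_coord t) measurable_snd, Measure.map_apply (f := (fun w : PathSpace X => w.1 t) ∘ Prod.fst) hm1 hA,
      Measure.map_apply (f := (fun w : PathSpace X => w.1 t) ∘ Prod.snd) hm2 hA] at h
    have hsub : {w : PathSpace X × PathSpace X | w.1.1 t ∈ A ∧ w.2.1 t ∉ A} ⊆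
        {w | (t : WithTop ℝ≥0) < couplingTime w} := by
      rintro w ⟨hw1, hw2⟩
      by_contra hlt
      have := couplingTime_le_iff.1 (not_lt.1 hlt) t le_rfl
      exact hw2 (this ▸ hw1)
    have hle : P {w | (t : WithTop ℝ≥0) < couplingTime w} ≤ P {w | w.1.1 t ∈ A ∧ w.2.1 t ∉ A} := by
      have hu : P ((fun w : PathSpace X × PathSpace X => w.1.1 t) ⁻¹' A) ≤
          P ((fun w : PathSpace X × PathSpace X => w.2.1 t) ⁻¹' A) +
            P {w | w.1.1 t ∈ A ∧ w.2.1 t ∉ A} := by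
        refine (measure_mono fun w hw => ?_).trans (measure_union_le _ _)
        by_cases h2 : w.2.1 t ∈ A
        · exact Or.inl h2
        · exact Or.inr ⟨hw, h2⟩
      exact (ENNReal.add_le_add_iff_left (measure_ne_top _ _)).1 (h.symm.le.trans hu)
    have hae := ae_eq_of_subset_of_measure_ge hsub hle
      ((hm1 hA).inter (hm2 hA).compl).nullMeasurableSet (measure_ne_top _ _)
    filter_upwards [hae] with w hw hlt
    exact hw.mpr hlt
  filter_upwards [key X₁ hR.isOpen_left.measurableSet subset_rfl hR.disjoint,
    key X₂ᶜ hR.isOpen_right.measurableSet.compl hR.disjoint.subset_compl_right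
      disjoint_compl_left] with w hw1 hw2 hlt
  exact ⟨(hw1 hlt).1, not_not.1 (hw2 hlt).2⟩

theorem mirrorCoupling_isMaximal [SecondCountableTopology X]
    (hR : Z.ReflectionStructure x₁ x₂ R X₁ X₂)
    (hx₁ : x₁ ∉ X₂) (hτ : IsStoppingTime (filtration X).rightCont (hittingTime {x | R x = x})) :
    Z.IsMaximal x₁ x₂ (Z.mirrorCoupling x₁ R) := by
  intro t _
  have hm : Measurable fun w : PathSpace X => (w, mirror R w) :=
    measurable_id.prodMk (measurable_mirror hτ)
  rw [IsMaximalAt, hR.phi_eq hx₁ hτ, mirrorCoupling,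
    Measure.map_apply hm (measurableSet_lt_couplingTime t)]
  refine measure_congr ?_
  filter_upwards [hR.ae_mem_left_of_lt_hittingTime hx₁] with w hw
  refine propext ⟨fun h => lt_of_lt_of_le h (couplingTime_mirror_le w), fun h => ?_⟩
  change (t : WithTop ℝ≥0) < couplingTime (w, mirror R w)
  by_contra hlt
  have he := couplingTime_le_iff.1 (not_lt.1 hlt) t le_rfl
  simp only [mirror_of_lt h] at he
  have hm := Or.inl (b := w.1 t ∈ X₂) (hw t h)
  have hm' : w.1 t ∈ X₁ ∪ X₂ := hm
  rw [hR.union_eq] at hm'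
  exact hm' he.symm

end ReflectionStructure

end Diffusion

/-! ### Comparing measures on a generating algebra. -/

/-- Every measurable set is approximated by sets of the algebra in symmetric difference, for `μ + ν`
and hence for both measures at once. -/
theorem measure_le_of_forall_mem_isSetAlgebra {α : Type*} [mα : MeasurableSpace α]
    {μ ν : Measure α} [IsFiniteMeasure μ] [IsFiniteMeasure ν] {C : Set (Set α)}
    (hC : IsSetAlgebra C) (hgen : mα = MeasurableSpace.generateFrom C)
    (h : ∀ t ∈ C, ν t ≤ μ t) {s : Set α} (hs : MeasurableSet s) : ν s ≤ μ s := by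
  refine ENNReal.le_of_forall_pos_le_add fun ε hε _ => ?_
  have hε' : (0 : ℝ≥0∞) < (ε / 2 : ℝ≥0) := ENNReal.coe_pos.2 (half_pos hε)
  obtain ⟨t, htC, ht⟩ := exists_measure_symmDiff_lt_of_generateFrom_isSetRing (μ := μ + ν)
    hC.isSetRing ⟨{univ}, countable_singleton _, by simpa using hC.univ_mem, by simp⟩ hgen hs hε'
  rw [Measure.add_apply] at ht
  have hμ : μ (symmDiff t s) ≤ (ε / 2 : ℝ≥0) := le_self_add.trans ht.le
  have hν : ν (symmDiff t s) ≤ (ε / 2 : ℝ≥0) := le_add_self.trans ht.le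
  calc ν s ≤ ν (t ∪ symmDiff t s) := measure_mono fun x hx => by
        by_cases hxt : x ∈ t
        · exact Or.inl hxt
        · exact Or.inr (Or.inr ⟨hx, hxt⟩)
    _ ≤ ν t + ν (symmDiff t s) := measure_union_le _ _
    _ ≤ μ t + (ε / 2 : ℝ≥0) := add_le_add (h t htC) hν
    _ ≤ (μ s + (ε / 2 : ℝ≥0)) + (ε / 2 : ℝ≥0) := by
        gcongr
        refine (measure_mono fun x hx => ?_).trans
          ((measure_union_le s (symmDiff t s)).trans (by gcongr))
        by_cases hxs : x ∈ s
        · exact Or.inl hxs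
        · exact Or.inr (Or.inl ⟨hx, hxs⟩)
    _ = μ s + ε := by rw [add_assoc, ← ENNReal.coe_add, add_halves]

/-! ### Pairs of paths that mirror each other until they meet. -/

namespace PathSpace

variable {X : Type*} [TopologicalSpace X] [T2Space X] {R : C(X, X)}
  {p : PathSpace X × PathSpace X} {a : ℝ≥0}

theorem eq_mirror_of_lt_of_dense
    (h : ∀ k, 0 < TopologicalSpace.denseSeq ℝ≥0 k → TopologicalSpace.denseSeq ℝ≥0 k < a →
      p.2.1 (TopologicalSpace.denseSeq ℝ≥0 k) = R (p.1.1 (TopologicalSpace.denseSeq ℝ≥0 k)))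
    {u : ℝ≥0} (h0 : 0 < u) (hu : u ≤ a) : p.2.1 u = R (p.1.1 u) := by
  have hcl : IsClosed {t | p.2.1 t = R (p.1.1 t)} :=
    isClosed_eq p.2.2 (R.continuous.comp p.1.2)
  have hsub : closure (Ioo 0 a ∩ range (TopologicalSpace.denseSeq ℝ≥0)) ⊆
      {t | p.2.1 t = R (p.1.1 t)} := by
    refine closure_minimal ?_ hcl
    rintro _ ⟨hk, k, rfl⟩
    exact h k hk.1 hk.2
  have hd := (TopologicalSpace.denseRange_denseSeq ℝ≥0).open_subset_closure_inter
    (isOpen_Ioo (a := 0) (b := a))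
  have hcl' := closure_minimal hd isClosed_closure
  rw [closure_Ioo (h0.trans_le hu).ne] at hcl'
  exact hsub (hcl' ⟨zero_le, hu⟩)

variable {t₀ : ℝ≥0}

theorem eq_map_of_le_couplingTime
    (h1 : ∀ k, 0 < TopologicalSpace.denseSeq ℝ≥0 k → TopologicalSpace.denseSeq ℝ≥0 k < t₀ →
      (TopologicalSpace.denseSeq ℝ≥0 k : WithTop ℝ≥0) < couplingTime p →
        p.2.1 (TopologicalSpace.denseSeq ℝ≥0 k) = R (p.1.1 (TopologicalSpace.denseSeq ℝ≥0 k)))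
    {u : ℝ≥0} (hu0 : 0 < u) (hut : u ≤ t₀) (hu : (u : WithTop ℝ≥0) ≤ couplingTime p) :
    p.2.1 u = R (p.1.1 u) :=
  eq_mirror_of_lt_of_dense (a := u) (fun k hk0 hk => h1 k hk0 (hk.trans_le hut)
    ((WithTop.coe_lt_coe.2 hk).trans_le hu)) hu0 le_rfl

/-- A pair of paths which are mirror images of each other before they meet does not meet before
the first path hits the mirror. -/
theorem lt_couplingTime_of_lt_hittingTime
    (h1 : ∀ k, 0 < TopologicalSpace.denseSeq ℝ≥0 k → TopologicalSpace.denseSeq ℝ≥0 k < t₀ →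
      (TopologicalSpace.denseSeq ℝ≥0 k : WithTop ℝ≥0) < couplingTime p →
        p.2.1 (TopologicalSpace.denseSeq ℝ≥0 k) = R (p.1.1 (TopologicalSpace.denseSeq ℝ≥0 k)))
    (h0 : p.1.1 0 = p.2.1 0 → hittingTime {x | R x = x} p.1 = 0)
    {u : ℝ≥0} (hut : u < t₀) (hu : (u : WithTop ℝ≥0) < hittingTime {x | R x = x} p.1) :
    (u : WithTop ℝ≥0) < couplingTime p := by
  by_contra! hle
  obtain ⟨r, hr⟩ := WithTop.ne_top_iff_exists.1 (hle.trans_lt (WithTop.coe_lt_top u)).ne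
  have hru : r ≤ u := by rwa [← hr, WithTop.coe_le_coe] at hle
  have heq := couplingTime_le_iff.1 hr.symm.le r le_rfl
  -- At a positive meeting time the two points are equal and mirror images of each other, so they
  -- lie on `H`; meeting at time `0` is the case covered by `h0`.
  rcases eq_or_ne r 0 with rfl | hr0
  · rw [h0 heq] at hu
    exact not_lt_zero hu
  · have hr0' := pos_iff_ne_zero.2 hr0
    have hm := eq_map_of_le_couplingTime h1 hr0' (hru.trans hut.le) hr.le
    have := hittingTime_le (H := {x | R x = x}) hr0' (show R (p.1.1 r) = p.1.1 r by rw [← hm, heq])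
    exact not_lt.2 (this.trans (WithTop.coe_le_coe.2 hru)) hu

/-- If moreover the paths have met as soon as the first path hits the mirror, then the second path
is the mirror image of the first one up to time `t₀`. -/
theorem stopAt_eq_stopAt_mirror
    (h1 : ∀ k, 0 < TopologicalSpace.denseSeq ℝ≥0 k → TopologicalSpace.denseSeq ℝ≥0 k < t₀ →
      (TopologicalSpace.denseSeq ℝ≥0 k : WithTop ℝ≥0) < couplingTime p →
        p.2.1 (TopologicalSpace.denseSeq ℝ≥0 k) = R (p.1.1 (TopologicalSpace.denseSeq ℝ≥0 k)))
    (h2 : ∀ k, 0 < TopologicalSpace.denseSeq ℝ≥0 k → TopologicalSpace.denseSeq ℝ≥0 k < t₀ →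
      (TopologicalSpace.denseSeq ℝ≥0 k : WithTop ℝ≥0) < couplingTime p →
        (TopologicalSpace.denseSeq ℝ≥0 k : WithTop ℝ≥0) < hittingTime {x | R x = x} p.1)
    (h0 : p.1.1 0 = p.2.1 0 → hittingTime {x | R x = x} p.1 = 0)
    (hstart : p.2.1 0 = R (p.1.1 0)) :
    stopAt t₀ p.2 = stopAt t₀ (mirror R p.1) := by
  have key : ∀ u, u ≤ t₀ → (u : WithTop ℝ≥0) ≤ hittingTime {x | R x = x} p.1 →
      p.2.1 u = R (p.1.1 u) := by
    intro u hut hu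
    rcases eq_or_ne u 0 with rfl | hu0
    · exact hstart
    · exact eq_mirror_of_lt_of_dense (a := u) (fun k hk0 hk => h1 k hk0 (hk.trans_le hut)
        (lt_couplingTime_of_lt_hittingTime h1 h0 (hk.trans_le hut)
          ((WithTop.coe_lt_coe.2 hk).trans_le hu))) (pos_iff_ne_zero.2 hu0) le_rfl
  refine Subtype.ext (funext fun t => ?_)
  change p.2.1 (min t t₀) = (mirror R p.1).1 (min t t₀)
  have hut : min t t₀ ≤ t₀ := min_le_right _ _
  generalize min t t₀ = u at hut
  rcases lt_or_ge (u : WithTop ℝ≥0) (hittingTime {x | R x = x} p.1) with h | h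
  · rw [mirror_of_lt h, key u hut h.le]
  · rw [mirror_of_le h]
    obtain ⟨r, hr⟩ := WithTop.ne_top_iff_exists.1 (h.trans_lt (WithTop.coe_lt_top u)).ne
    rw [← hr, WithTop.coe_le_coe] at h
    rcases (h.trans hut).lt_or_eq with hrt | rfl
    · refine (couplingTime_le_iff (t := r).1 (le_of_not_gt fun hlt => ?_) u h).symm
      -- If the paths had not met by the hitting time `r`, a dense time in `(r, v)` would contradict
      -- `h2`.
      obtain ⟨v, hrv, hv⟩ : ∃ v, r < v ∧ v ≤ t₀ ∧ (v : WithTop ℝ≥0) ≤ couplingTime p := by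
        generalize couplingTime p = T at hlt
        induction T using WithTop.recTopCoe with
        | top => exact ⟨t₀, hrt, le_rfl, le_top⟩
        | coe T => exact ⟨min T t₀, lt_min (WithTop.coe_lt_coe.1 hlt) hrt, min_le_right _ _,
            WithTop.coe_le_coe.2 (min_le_left _ _)⟩
      obtain ⟨k, hk⟩ := (TopologicalSpace.denseRange_denseSeq ℝ≥0).exists_mem_open isOpen_Ioo
        (nonempty_Ioo.2 hrv)
      have := h2 k (lt_of_le_of_lt zero_le hk.1) (hk.2.trans_le hv.1)
        ((WithTop.coe_lt_coe.2 hk.2).trans_le hv.2)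
      rw [← hr, WithTop.coe_lt_coe] at this
      exact lt_asymm this hk.1
    -- When the hitting time is exactly `t₀`, no later time is available; the mirror relation at
    -- `t₀` and the position on `H` give equality there.
    · obtain rfl := le_antisymm hut h
      rw [key u le_rfl hr.le]
      exact mem_of_hittingTime_eq (isClosed_fixed R) hr.symm

end PathSpace

/-! ### Rigidity of maximal Markovian couplings. -/

namespace Diffusion

variable {X : Type*} [TopologicalSpace X] [MeasurableSpace X] {Z : Diffusion X}

/-- If two components of a Markovian family agree at time `s + r` as soon as the first one is in
`U`, then on `U` the transition probabilities of the first one are dominated by those of the second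
one. -/
theorem ae_lawAt_le [MeasurableSpace.CountablyGenerated X]
    {P : Measure (PathSpace X × PathSpace X)} [IsFiniteMeasure P]
    {π π' : PathSpace X × PathSpace X → PathSpace X} (hπm : Measurable π) (hπm' : Measurable π')
    {s : ℝ≥0}
    (hπ : ∀ A : Set (PathSpace X), MeasurableSet A →
      P⟦{w | shift s (π w) ∈ A} | pairFiltration X s⟧ =ᵐ[P] fun w => (Z.law ((π w).1 s)).real A)
    (hπ' : ∀ A : Set (PathSpace X), MeasurableSet A →
      P⟦{w | shift s (π' w) ∈ A} | pairFiltration X s⟧ =ᵐ[P] fun w => (Z.law ((π' w).1 s)).real A)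
    (r : ℝ≥0) {U : Set X} (hU : MeasurableSet U)
    (h : ∀ᵐ w ∂P, (π w).1 (s + r) ∈ U → (π w).1 (s + r) = (π' w).1 (s + r)) :
    ∀ᵐ w ∂P, ∀ A : Set X, MeasurableSet A → A ⊆ U →
      Z.lawAt r ((π w).1 s) A ≤ Z.lawAt r ((π' w).1 s) A := by
  have hsingle : ∀ A : Set X, MeasurableSet A → ∀ᵐ w ∂P,
      Z.lawAt r ((π w).1 s) (A ∩ U) ≤ Z.lawAt r ((π' w).1 s) (A ∩ U) := by
    intro A hA
    have hm : MeasurableSet {w : PathSpace X | w.1 r ∈ A ∩ U} := measurable_coord r (hA.inter hU)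
    have i1 : MeasurableSet {w | shift s (π w) ∈ {w : PathSpace X | w.1 r ∈ A ∩ U}} :=
      (measurable_shift s).comp hπm hm
    have i2 : MeasurableSet {w | shift s (π' w) ∈ {w : PathSpace X | w.1 r ∈ A ∩ U}} :=
      (measurable_shift s).comp hπm' hm
    have hle := condExp_mono (m := pairFiltration X s) (μ := P)
      ((integrable_const (1 : ℝ)).indicator i1) ((integrable_const (1 : ℝ)).indicator i2) (by
        filter_upwards [h] with w hw
        by_cases hw1 : (π w).1 (s + r) ∈ A ∩ U
        · have e1 : w ∈ {w | (shift s (π w)).1 r ∈ A ∩ U} := hw1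
          have e2 : w ∈ {w | (shift s (π' w)).1 r ∈ A ∩ U} := by
            change (π' w).1 (s + r) ∈ A ∩ U
            rwa [← hw hw1.2]
          rw [indicator_of_mem e1, indicator_of_mem e2]
        · have e1 : w ∉ {w | (shift s (π w)).1 r ∈ A ∩ U} := hw1
          rw [indicator_of_notMem e1]
          exact indicator_nonneg (fun _ _ => zero_le_one) _)
    filter_upwards [hle, hπ _ hm, hπ' _ hm] with w hw h1 h2
    have h3 := (h1.symm.le.trans hw).trans h2.le
    rw [lawAt, lawAt, Measure.map_apply (measurable_coord r) (hA.inter hU),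
      Measure.map_apply (measurable_coord r) (hA.inter hU)]
    exact (ENNReal.toReal_le_toReal (measure_ne_top _ _) (measure_ne_top _ _)).1 h3
  -- The exceptional null set depends on `A`; a countable generating algebra yields one null set for
  -- all `A`.
  obtain ⟨b, hbc, hb⟩ := MeasurableSpace.CountablyGenerated.isCountablyGenerated (α := X)
  have hgen : ‹MeasurableSpace X› = MeasurableSpace.generateFrom (generateSetAlgebra b) := by
    rw [generateFrom_generateSetAlgebra_eq]
    exact hb
  have hall := (ae_ball_iff (countable_generateSetAlgebra hbc)).2 fun A hA => hsingle A (by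
    rw [hgen]
    exact MeasurableSpace.measurableSet_generateFrom hA)
  filter_upwards [hall] with w hw A hA hAU
  have := measure_le_of_forall_mem_isSetAlgebra (μ := (Z.lawAt r ((π' w).1 s)).restrict U)
    (ν := (Z.lawAt r ((π w).1 s)).restrict U) isSetAlgebra_generateSetAlgebra hgen
    (fun t ht => by
      rw [Measure.restrict_apply' hU, Measure.restrict_apply' hU]
      exact hw t ht) hA
  rwa [Measure.restrict_apply' hU, Measure.restrict_apply' hU, inter_eq_left.2 hAU] at this

variable [T2Space X] [BorelSpace X] [SecondCountableTopology X]
  {x₁ x₂ : X} {R : C(X, X)} {X₁ X₂ : Set X}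

namespace ReflectionStructure

/-- A Markovian coupling of the class `Ĉ` which is maximal before `t₀` consists of mirror images
until the paths meet. -/
theorem ae_eq_of_lt_couplingTime (hR : Z.ReflectionStructure x₁ x₂ R X₁ X₂) (hx₁ : x₁ ∉ X₂)
    (hτ : IsStoppingTime (filtration X).rightCont (hittingTime {x | R x = x}))
    {P : Measure (PathSpace X × PathSpace X)} (hhat : P ∈ Z.hatCouplings x₁ x₂ R X₁ X₂)
    (hmarkov : P ∈ Z.markovCouplings x₁ x₂) {t₀ : ℝ≥0}
    (hmax : ∀ t : ℝ≥0, 0 < t → t < t₀ → Z.IsMaximalAt x₁ x₂ P t) {s : ℝ≥0} (hs0 : 0 < s)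
    (hs : s < t₀) :
    ∀ᵐ w ∂P, (s : WithTop ℝ≥0) < couplingTime w → w.2.1 s = R (w.1.1 s) := by
  obtain ⟨hcoup, hΞ⟩ := hhat
  have hprob := hcoup.1
  obtain ⟨Ξ, -, -, hΞ0, hΞR⟩ := hΞ s hs0
  have hsides : ∀ r, 0 < r → s + r < t₀ →
      ∀ᵐ w ∂P, ((s + r : ℝ≥0) : WithTop ℝ≥0) < couplingTime w →
        w.1.1 (s + r) ∈ X₁ ∧ w.2.1 (s + r) ∈ X₂ := fun r hr hrt =>
    hR.ae_mem_and_mem_of_isMaximalAt hx₁ hτ hcoup (hmax _ (add_pos hs0 hr) hrt)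
  have hmH : MeasurableSet {x | R x = x} := (isClosed_fixed R).measurableSet
  have hcomp : ∀ r, 0 < r → s + r < t₀ → ∀ᵐ w ∂P,
      (∀ A : Set X, MeasurableSet A → A ⊆ X₁ ∪ {z | R z = z} →
        Z.lawAt r (w.2.1 s) A ≤ Z.lawAt r (w.1.1 s) A) ∧
      (∀ A : Set X, MeasurableSet A → A ⊆ X₂ ∪ {z | R z = z} →
        Z.lawAt r (w.1.1 s) A ≤ Z.lawAt r (w.2.1 s) A) := by
    intro r hr hrt
    refine (ae_lawAt_le measurable_snd measurable_fst (fun A hA => (hmarkov.2 s hs0 A hA).2)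
      (fun A hA => (hmarkov.2 s hs0 A hA).1) r (hR.isOpen_left.measurableSet.union hmH) ?_).and
      (ae_lawAt_le measurable_fst measurable_snd (fun A hA => (hmarkov.2 s hs0 A hA).1)
      (fun A hA => (hmarkov.2 s hs0 A hA).2) r (hR.isOpen_right.measurableSet.union hmH) ?_)
    -- If the components differ at `s + r`, they have not yet met, so the second one lies in `X₂`,
    -- contrary to `hwU`.
    · filter_upwards [hsides r hr hrt] with w hw hwU
      by_contra hne
      refine hR.notMem_right hwU (hw ?_).2
      by_contra hlt
      exact hne (couplingTime_le_iff.1 (not_lt.1 hlt) _ le_rfl).symm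
    · filter_upwards [hsides r hr hrt] with w hw hwU
      by_contra hne
      refine hR.notMem_left hwU (hw ?_).1
      by_contra hlt
      exact hne (couplingTime_le_iff.1 (not_lt.1 hlt) _ le_rfl)
  -- The denominator `n + 2` keeps `s + r n` strictly below `t₀` already for `n = 0`, since
  -- maximality is only assumed before `t₀`.
  let r : ℕ → ℝ≥0 := fun n => (t₀ - s) * (1 / ((n : ℝ≥0) + 2))
  have hts : 0 < t₀ - s := tsub_pos_of_lt hs
  have hr0 : ∀ n, 0 < r n := fun n => mul_pos hts (by positivity)
  have hrt : ∀ n, s + r n < t₀ := by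
    intro n
    have h1 : (1 : ℝ≥0) / ((n : ℝ≥0) + 2) < 1 := by
      rw [div_lt_one (by positivity)]
      exact lt_of_lt_of_le one_lt_two le_add_self
    have h2 : r n < t₀ - s := mul_lt_of_lt_one_right hts h1
    exact lt_tsub_iff_left.1 h2
  have hanti : Antitone r := fun m n hmn => by
    refine mul_le_mul_of_nonneg_left (one_div_le_one_div_of_le (by positivity) ?_) zero_le
    gcongr
  have hlim : Tendsto r atTop (𝓝 0) := by
    have h := (tendsto_const_nhds (x := t₀ - s)).mul
      ((tendsto_add_atTop_iff_nat 1).2 (tendsto_one_div_add_atTop_nhds_zero_nat (𝕜 := ℝ≥0)))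
    rw [mul_zero] at h
    refine h.congr fun n => ?_
    simp only [r]
    push_cast
    rw [add_assoc, one_add_one_eq_two]
  filter_upwards [ae_all_iff.2 fun n => hcomp (r n) (hr0 n) (hrt n),
    measure_eq_zero_iff_ae_notMem.1 hΞ0,
    hR.ae_mem_and_mem_of_isMaximalAt hx₁ hτ hcoup (hmax s hs0 hs)] with w hw hwΞ hwX hlt
  -- The exceptional set is null only inside `X₁ × X₂`, so maximality at time `s` itself is needed
  -- here.
  have hmem : (w.1.1 s, w.2.1 s) ∈ Ξ := by
    by_contra hn
    exact hwΞ ⟨hn, hwX hlt⟩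
  rw [hΞR _ _ hmem ⟨r, hanti, hr0, hlim, hw⟩, hR.involutive]

theorem ae_stopAt_eq (hR : Z.ReflectionStructure x₁ x₂ R X₁ X₂) (hx₁ : x₁ ∉ X₂)
    (hτ : IsStoppingTime (filtration X).rightCont (hittingTime {x | R x = x}))
    {P : Measure (PathSpace X × PathSpace X)} (hhat : P ∈ Z.hatCouplings x₁ x₂ R X₁ X₂)
    (hmarkov : P ∈ Z.markovCouplings x₁ x₂) {t₀ : ℝ≥0}
    (hmax : ∀ t : ℝ≥0, 0 < t → t < t₀ → Z.IsMaximalAt x₁ x₂ P t) :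
    ∀ᵐ w ∂P, stopAt t₀ w.2 = stopAt t₀ (mirror R w.1) := by
  obtain ⟨hprob, hfst, hsnd⟩ := hhat.1
  have hst1 : ∀ᵐ w ∂P, w.1.1 0 = x₁ := by
    have h := Z.law_start x₁
    rw [← hfst] at h
    exact ae_of_ae_map measurable_fst.aemeasurable h
  have hst2 : ∀ᵐ w ∂P, w.2.1 0 = x₂ := by
    have h := Z.law_start x₂
    rw [← hsnd] at h
    exact ae_of_ae_map measurable_snd.aemeasurable h
  have h0 : ∀ᵐ w ∂P, w.1.1 0 = w.2.1 0 → hittingTime {x | R x = x} w.1 = 0 := by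
    by_cases hx : R x₁ = x₁
    · have h := hR.ae_hittingTime_eq_zero hx
      rw [← hfst] at h
      filter_upwards [ae_of_ae_map measurable_fst.aemeasurable h] with w hw _ using hw
    · filter_upwards [hst1, hst2] with w h1 h2 h
      exact absurd (hR.map_start.trans (h2.symm.trans (h.symm.trans h1))) hx
  have h1 : ∀ᵐ w ∂P, ∀ k, 0 < TopologicalSpace.denseSeq ℝ≥0 k →
      TopologicalSpace.denseSeq ℝ≥0 k < t₀ →
      (TopologicalSpace.denseSeq ℝ≥0 k : WithTop ℝ≥0) < couplingTime w →
        w.2.1 (TopologicalSpace.denseSeq ℝ≥0 k) = R (w.1.1 (TopologicalSpace.denseSeq ℝ≥0 k)) := by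
    refine ae_all_iff.2 fun k => ?_
    by_cases hk : 0 < TopologicalSpace.denseSeq ℝ≥0 k ∧ TopologicalSpace.denseSeq ℝ≥0 k < t₀
    · filter_upwards [hR.ae_eq_of_lt_couplingTime hx₁ hτ hhat hmarkov hmax hk.1 hk.2]
        with w hw _ _ using hw
    · exact Eventually.of_forall fun w hk0 hkt => absurd ⟨hk0, hkt⟩ hk
  have h2 : ∀ᵐ w ∂P, ∀ k, 0 < TopologicalSpace.denseSeq ℝ≥0 k →
      TopologicalSpace.denseSeq ℝ≥0 k < t₀ →
      (TopologicalSpace.denseSeq ℝ≥0 k : WithTop ℝ≥0) < couplingTime w →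
        (TopologicalSpace.denseSeq ℝ≥0 k : WithTop ℝ≥0) < hittingTime {x | R x = x} w.1 := by
    refine ae_all_iff.2 fun k => ?_
    generalize TopologicalSpace.denseSeq ℝ≥0 k = t
    by_cases ht : 0 < t ∧ t < t₀
    · have hlt := measurableSet_of_rightCont (measurableSet_lt_of_isStoppingTime hτ t)
      have hm : MeasurableSet {w : PathSpace X × PathSpace X |
          (t : WithTop ℝ≥0) < hittingTime {x | R x = x} w.1} := measurable_fst hlt
      have heq : P {w | (t : WithTop ℝ≥0) < couplingTime w} =
          P {w | (t : WithTop ℝ≥0) < hittingTime {x | R x = x} w.1} := by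
        rw [hmax t ht.1 ht.2, hR.phi_eq hx₁ hτ, ← hfst, Measure.map_apply measurable_fst hlt]
        rfl
      have hsub : {w : PathSpace X × PathSpace X |
          (t : WithTop ℝ≥0) < hittingTime {x | R x = x} w.1} ≤ᵐ[P]
          {w | (t : WithTop ℝ≥0) < couplingTime w} := by
        filter_upwards [h1, h0] with w hw1 hw0 hw
        exact lt_couplingTime_of_lt_hittingTime hw1 hw0 ht.2 hw
      -- Nested events of equal finite probability coincide almost surely, which reverses the
      -- pathwise inclusion.
      filter_upwards [ae_eq_of_ae_subset_of_measure_ge hsub heq.le hm.nullMeasurableSet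
        (measure_ne_top _ _)] with w hw _ _ hlt
      exact hw.mpr hlt
    · exact Eventually.of_forall fun w hk0 hkt => absurd ⟨hk0, hkt⟩ ht
  filter_upwards [h0, h1, h2, hst1, hst2] with w hw0 hw1 hw2 hs1 hs2
  exact stopAt_eq_stopAt_mirror hw1 hw2 hw0 (by rw [hs1, hs2, hR.map_start])

theorem eq_mirrorCoupling (hR : Z.ReflectionStructure x₁ x₂ R X₁ X₂) (hx₁ : x₁ ∉ X₂)
    (hτ : IsStoppingTime (filtration X).rightCont (hittingTime {x | R x = x}))
    {P : Measure (PathSpace X × PathSpace X)} (hhat : P ∈ Z.hatCouplings x₁ x₂ R X₁ X₂)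
    (hmarkov : P ∈ Z.markovCouplings x₁ x₂) (hmax : Z.IsMaximal x₁ x₂ P) :
    P = Z.mirrorCoupling x₁ R := by
  have hm : Measurable fun w : PathSpace X => (w, mirror R w) :=
    measurable_id.prodMk (measurable_mirror hτ)
  have hae : ∀ᵐ w ∂P, (w.1, mirror R w.1) = w := by
    -- Integer horizons suffice to identify whole paths outside a single null set.
    filter_upwards [ae_all_iff.2 fun n : ℕ => hR.ae_stopAt_eq hx₁ hτ hhat hmarkov (t₀ := n)
      fun t ht _ => hmax t ht] with w hw
    refine Prod.ext rfl (Subtype.ext (funext fun t => ?_))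
    obtain ⟨n, hn⟩ := exists_nat_ge t
    have h := congrArg (fun v : PathSpace X => v.1 t) (hw n)
    simpa [stopAt, min_eq_left hn] using h.symm
  rw [mirrorCoupling, ← hhat.1.2.1, Measure.map_map hm measurable_fst]
  conv_lhs => rw [← Measure.map_id (μ := P)]
  exact Measure.map_congr (hae.mono fun w hw => hw.symm)

theorem map_stopAt_eq (hR : Z.ReflectionStructure x₁ x₂ R X₁ X₂) (hx₁ : x₁ ∉ X₂)
    (hτ : IsStoppingTime (filtration X).rightCont (hittingTime {x | R x = x}))
    {P : Measure (PathSpace X × PathSpace X)} (hhat : P ∈ Z.hatCouplings x₁ x₂ R X₁ X₂)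
    (hmarkov : P ∈ Z.markovCouplings x₁ x₂) {t₀ : ℝ≥0}
    (hmax : ∀ t : ℝ≥0, 0 < t → t < t₀ → Z.IsMaximalAt x₁ x₂ P t) :
    P.map (Prod.map (stopAt t₀) (stopAt t₀)) =
      (Z.mirrorCoupling x₁ R).map (Prod.map (stopAt t₀) (stopAt t₀)) := by
  have hm : Measurable fun w : PathSpace X => (w, mirror R w) :=
    measurable_id.prodMk (measurable_mirror hτ)
  have hms : Measurable (Prod.map (stopAt t₀) (stopAt t₀) :
      PathSpace X × PathSpace X → PathSpace X × PathSpace X) :=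
    (measurable_stopAt t₀).prodMap (measurable_stopAt t₀)
  rw [mirrorCoupling, ← hhat.1.2.1, Measure.map_map hm measurable_fst,
    Measure.map_map hms (hm.comp measurable_fst)]
  refine Measure.map_congr ?_
  filter_upwards [hR.ae_stopAt_eq hx₁ hτ hhat hmarkov hmax] with w hw
  exact Prod.ext rfl hw

end ReflectionStructure

end Diffusion

theorem mainTheorem1 {X : Type*} [TopologicalSpace X] [T2Space X] [SecondCountableTopology X]
    [PathConnectedSpace X] [MeasurableSpace X] [BorelSpace X]
    (Z : Diffusion X) (x₁ x₂ : X) (R : C(X, X)) (X₁ X₂ : Set X)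
    (hR : Z.ReflectionStructure x₁ x₂ R X₁ X₂) (hx₁ : x₁ ∉ X₂)
    (hτ : IsStoppingTime (PathSpace.filtration X).rightCont
      (PathSpace.hittingTime {x | R x = x})) :
    (∀ P ∈ Z.hatCouplings x₁ x₂ R X₁ X₂ ∩ Z.markovCouplings x₁ x₂, ∀ t₀ : ℝ≥0, 0 < t₀ →
      (∀ t : ℝ≥0, 0 < t → t < t₀ → Z.IsMaximalAt x₁ x₂ P t) →
      P.map (Prod.map (PathSpace.stopAt t₀) (PathSpace.stopAt t₀))
        = (Z.mirrorCoupling x₁ R).map (Prod.map (PathSpace.stopAt t₀) (PathSpace.stopAt t₀))) ∧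
    (∀ P ∈ Z.hatCouplings x₁ x₂ R X₁ X₂ ∩ Z.markovCouplings x₁ x₂,
      Z.IsMaximal x₁ x₂ P → P = Z.mirrorCoupling x₁ R) ∧
    (Z.markovCouplings x₁ x₂ ⊆ Z.hatCouplings x₁ x₂ R X₁ X₂ →
      ∀ P : Measure (PathSpace X × PathSpace X),
        (P ∈ Z.markovCouplings x₁ x₂ ∧ Z.IsMaximal x₁ x₂ P) ↔ P = Z.mirrorCoupling x₁ R) := by
  refine ⟨fun P hP t₀ _ hmax => hR.map_stopAt_eq hx₁ hτ hP.1 hP.2 hmax,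
    fun P hP hmax => hR.eq_mirrorCoupling hx₁ hτ hP.1 hP.2 hmax, fun hsub P => ⟨?_, ?_⟩⟩
  · rintro ⟨hP, hmax⟩
    exact hR.eq_mirrorCoupling hx₁ hτ (hsub hP) hP hmax
  · rintro rfl
    exact ⟨hR.mirrorCoupling_mem_markovCouplings hτ, hR.mirrorCoupling_isMaximal hx₁ hτ⟩
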